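/- **Setting.** Fix $\tau>0$ and a twice differentiable, convex, non-linear function $\rho:\mathbb R\to[0,\infty)$ with $\rho(0)=0$; put $\psi=\rho'$. Assume that $|\psi(x)|=O(|x|^m)$ as $|x|\to\infty$ for some $m$, and that $\psi'$ is $L(u)$-Lipschitz on $(-u,u)$ for every $u>0$, where $L(u)\le K u^{m_1}$ for all large $u$, for some $K,m_1$. For each $n$ let $p=p(n)\ge 1$ with $p/n\to\kappa\in(0,\infty)$, and let $X_1,\dots,X_n$ (random vectors in $\mathbb R^p$) and $\varepsilon_1,\dots,\varepsilon_n$ (real random variables) be defined on a probability space that may depend on $n$ (as may all laws), such that: - the $X_i$ are i.i.d., have i.i.d. entries, mean $0$ and covariance $\mathrm{Id}_p$; for every convex $1$-Lipschitz $F:\mathbb R^p\to\mathbb R$ there is a deterministic $m_F$ (e.g. the mean or a median of $F(X_i)$) with $P(|F(X_i)-m_F|>t)\le C_n e^{-c_nt^2}$ for all $t>0$, where $c_n>0$, $1/c_n=O((\log n)^{a})$ for some $a$, and $C_n$ grows at most polynomially in $n$; - the $\varepsilon_i$ are independent, and $(\varepsilon_i)_{i\le n}$ is independent of $(X_i)_{i\le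 n}$; - for every fixed $k$, $\frac1n\sum_{i=1}^n\mathbb E\,\psi^{2k}(\varepsilon_i)$ is bounded for all large $n$; - $\sup_{i\le n}|\varepsilon_i|=O((\log n)^{b})$ for some $b$, in $L_k$ for every fixed $k$: $(\mathbb E\sup_{i\le n}|\varepsilon_i|^k)^{1/k}\le K_k(\log n)^b$ for all large $n$ (in particular this holds if $\sup_{i\le n}|\varepsilon_i|\le K(\log n)^b$ almost surely). For random variables $Z_n$ and numbers $a_n>0$ we write $Z_n=O_{L_k}(\mathrm{polyLog}(n)\,a_n)$ if there is an exponent $\alpha$ such that for every integer $k\ge1$ there is a constant $K_k$ with $(\mathbb E|Z_n|^k)^{1/k}\le K_k(\log n)^{\alpha}a_n$ for all large $n$. **Objects.** Let $\widehat\beta$ be the unique minimizer over $\beta\in\mathbb R^p$ of $\frac1n\sum_{i=1}^n\rho(\varepsilon_i-X_i^{\top}\beta)+\frac\tau2\|\beta\|^2$, and $R_i=\varepsilon_i-X_i^{\top}\widehat\beta$. Let $V_i\in\mathbb R^{p-1}$ be the vector of the first $p-1$ entries of $X_i$, and $X_i(p)$ its last entry. Let $\widehat\gamma$ be the unique minimizer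 over $\gamma\in\mathbb R^{p-1}$ of $\frac1n\sum_{i=1}^n\rho(\varepsilon_i-V_i^{\top}\gamma)+\frac\tau2\|\gamma\|^2$, and $r_{i,[p]}=\varepsilon_i-V_i^{\top}\widehat\gamma$. Put $$u_p=\frac1n\sum_{i=1}^n\psi'(r_{i,[p]})X_i(p)V_i,\qquad \mathfrak S_p=\frac1n\sum_{i=1}^n\psi'(r_{i,[p]})V_iV_i^{\top},$$ $$\xi_n=\frac1n\sum_{i=1}^nX_i(p)^2\psi'(r_{i,[p]})-u_p^{\top}(\mathfrak S_p+\tau\,\mathrm{Id})^{-1}u_p,\qquad N_p=\frac1{\sqrt n}\sum_{i=1}^nX_i(p)\psi(r_{i,[p]}),$$ $$\mathfrak b_p=\frac{N_p}{\sqrt n\,(\tau+\xi_n)},\qquad \widetilde b=\begin{bmatrix}\widehat\gamma\\0\end{bmatrix}+\mathfrak b_p\begin{bmatrix}-(\mathfrak S_p+\tau\,\mathrm{Id})^{-1}u_p\\1\end{bmatrix}.$$ **Statement.** Under these assumptions, $$\|\widehat\beta-\widetilde b\|\le\frac1\tau\,O_{L_k}\!\Big(\frac{\mathrm{polyLog}(n)}{n}\Big),$$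 and $$\sqrt n\,(\widehat\beta_p-\mathfrak b_p)=O_{L_k}\!\Big(\frac{\mathrm{polyLog}(n)}{\sqrt n}\Big),\quad \sup_{i\le n}|X_i^{\top}(\widehat\beta-\widetilde b)|=O_{L_k}\!\Big(\frac{\mathrm{polyLog}(n)}{\sqrt n}\Big),\quad \sup_{i\le n}|R_i-r_{i,[p]}|=O_{L_k}\!\Big(\frac{\mathrm{polyLog}(n)}{\sqrt n}\Big).$$ -/

import Mathlib

noncomputable section

namespace RidgeM

open MeasureTheory ProbabilityTheory Filter Topology

/-! ### The ridge-regularized M-estimator -/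

/-- `F(β) = (1/n) ∑ᵢ ρ(eᵢ - Xᵢᵀβ) + (τ/2) ‖β‖²`. -/
def objective (ρ : ℝ → ℝ) (τ : ℝ) {n d : ℕ} (e : Fin n → ℝ)
    (X : Fin n → EuclideanSpace ℝ (Fin d)) (β : EuclideanSpace ℝ (Fin d)) : ℝ :=
  (1 / (n : ℝ)) * ∑ i, ρ (e i - inner ℝ (X i) β) + τ / 2 * ‖β‖ ^ 2

/-- `argmin_β F(β)`. It is the unique minimizer under the assumptions of interest, see
`estimator_spec` and `eq_estimator`. -/
def estimator (ρ : ℝ → ℝ) (τ : ℝ) {n d : ℕ} (e : Fin n → ℝ)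
    (X : Fin n → EuclideanSpace ℝ (Fin d)) : EuclideanSpace ℝ (Fin d) :=
  Classical.epsilon fun β => ∀ β', objective ρ τ e X β ≤ objective ρ τ e X β'

theorem exists_minimizer {ρ : ℝ → ℝ} (hc : Continuous ρ) (h0 : ∀ x, 0 ≤ ρ x) {τ : ℝ}
    (hτ : 0 < τ) {n d : ℕ} (e : Fin n → ℝ) (X : Fin n → EuclideanSpace ℝ (Fin d)) :
    ∃ β, ∀ β', objective ρ τ e X β ≤ objective ρ τ e X β' := by
  have hcont : Continuous (objective ρ τ e X) := by
    unfold objective; fun_prop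
  refine hcont.exists_forall_le ?_
  have h1 : Tendsto (fun β : EuclideanSpace ℝ (Fin d) => τ / 2 * ‖β‖ ^ 2)
      (cocompact _) atTop :=
    ((tendsto_pow_atTop two_ne_zero).comp tendsto_norm_cocompact_atTop).const_mul_atTop
      (half_pos hτ)
  refine tendsto_atTop_mono (fun β => ?_) h1
  have : 0 ≤ (1 / (n : ℝ)) * ∑ i, ρ (e i - inner ℝ (X i) β) :=
    mul_nonneg (by positivity) (Finset.sum_nonneg fun i _ => h0 _)
  simpa [objective] using this

theorem estimator_spec {ρ : ℝ → ℝ} (hc : Continuous ρ) (h0 : ∀ x, 0 ≤ ρ x) {τ : ℝ}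
    (hτ : 0 < τ) {n d : ℕ} (e : Fin n → ℝ) (X : Fin n → EuclideanSpace ℝ (Fin d))
    (β : EuclideanSpace ℝ (Fin d)) :
    objective ρ τ e X (estimator ρ τ e X) ≤ objective ρ τ e X β :=
  Classical.epsilon_spec (exists_minimizer hc h0 hτ e X) β

theorem eq_estimator {ρ : ℝ → ℝ} (hc : Continuous ρ) (hv : ConvexOn ℝ Set.univ ρ)
    (h0 : ∀ x, 0 ≤ ρ x) {τ : ℝ} (hτ : 0 < τ) {n d : ℕ} (e : Fin n → ℝ)
    (X : Fin n → EuclideanSpace ℝ (Fin d)) (a : EuclideanSpace ℝ (Fin d))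
    (ha : ∀ β, objective ρ τ e X a ≤ objective ρ τ e X β) : a = estimator ρ τ e X := by
  set b := estimator ρ τ e X with hb
  have hb' : ∀ β, objective ρ τ e X b ≤ objective ρ τ e X β := estimator_spec hc h0 hτ e X
  set m : EuclideanSpace ℝ (Fin d) := (1 / 2 : ℝ) • a + (1 / 2 : ℝ) • b with hm
  have hsum : ∑ i, ρ (e i - inner ℝ (X i) m) ≤
      (1 / 2) * ∑ i, ρ (e i - inner ℝ (X i) a) + (1 / 2) * ∑ i, ρ (e i - inner ℝ (X i) b) := by
    rw [Finset.mul_sum, Finset.mul_sum, ← Finset.sum_add_distrib]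
    refine Finset.sum_le_sum fun i _ => ?_
    have h := hv.2 (Set.mem_univ (e i - inner ℝ (X i) a)) (Set.mem_univ (e i - inner ℝ (X i) b))
      (by norm_num : (0 : ℝ) ≤ 1 / 2) (by norm_num : (0 : ℝ) ≤ 1 / 2) (by norm_num)
    simp only [smul_eq_mul] at h
    refine le_trans (le_of_eq ?_) h
    congr 1
    rw [hm, inner_add_right, inner_smul_right, inner_smul_right]
    ring
  have hn : ‖m‖ ^ 2 = (1 / 2) * ‖a‖ ^ 2 + (1 / 2) * ‖b‖ ^ 2 - (1 / 4) * ‖a - b‖ ^ 2 := by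
    have h1 := parallelogram_law_with_norm ℝ a b
    have h2 : ‖m‖ = 1 / 2 * ‖a + b‖ := by
      rw [hm, ← smul_add, norm_smul]; norm_num
    rw [h2]; nlinarith
  have key : objective ρ τ e X m ≤
      (1 / 2) * objective ρ τ e X a + (1 / 2) * objective ρ τ e X b
        - τ / 8 * ‖a - b‖ ^ 2 := by
    have h3 := mul_le_mul_of_nonneg_left hsum (by positivity : (0 : ℝ) ≤ 1 / (n : ℝ))
    unfold objective
    rw [hn]
    linarith
  have h4 := ha m
  have h5 := hb' m
  have h6 : ‖a - b‖ ^ 2 ≤ 0 := by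
    by_contra! h
    have : 0 < τ / 8 * ‖a - b‖ ^ 2 := by positivity
    linarith
  have h7 : ‖a - b‖ = 0 := by
    have := sq_nonneg ‖a - b‖
    exact pow_eq_zero_iff two_ne_zero |>.1 (le_antisymm h6 this)
  exact sub_eq_zero.1 (norm_eq_zero.1 h7)

/-- The residual `Rᵢ = eᵢ - Xᵢᵀβ̂`. -/
def residual (ρ : ℝ → ℝ) (τ : ℝ) {n d : ℕ} (e : Fin n → ℝ)
    (X : Fin n → EuclideanSpace ℝ (Fin d)) (i : Fin n) : ℝ :=
  e i - inner ℝ (X i) (estimator ρ τ e X)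

/-! ### Leaving out the last predictor

There are `p = q + 1` predictors; `ψ = ρ'` is `deriv ρ` and `ψ'` is `deriv (deriv ρ)`. -/

section LeaveOnePredictorOut

variable (ρ : ℝ → ℝ) (τ : ℝ) {n q : ℕ} (e : Fin n → ℝ)
  (X : Fin n → EuclideanSpace ℝ (Fin (q + 1)))

/-- `Xᵢ(p)`, the last entry of `Xᵢ`. -/
def lastEntry (i : Fin n) : ℝ := X i (Fin.last q)

/-- `Vᵢ`, the first `p - 1` entries of `Xᵢ`. -/
def firstEntries (i : Fin n) : EuclideanSpace ℝ (Fin q) :=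
  WithLp.toLp 2 fun j => X i j.castSucc

/-- `γ̂`, the estimator computed from the design `V`. -/
def gammaHat : EuclideanSpace ℝ (Fin q) := estimator ρ τ e (firstEntries X)

/-- `r_{i,[p]} = eᵢ - Vᵢᵀγ̂`. -/
def looResidual (i : Fin n) : ℝ := e i - inner ℝ (firstEntries X i) (gammaHat ρ τ e X)

/-- `u_p = (1/n) ∑ᵢ ψ'(r_{i,[p]}) Xᵢ(p) Vᵢ`. -/
def uVec : Fin q → ℝ := fun j =>
  (1 / (n : ℝ)) * ∑ i, deriv (deriv ρ) (looResidual ρ τ e X i) * firstEntries X i j *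
    lastEntry X i

/-- `𝔖_p = (1/n) ∑ᵢ ψ'(r_{i,[p]}) Vᵢ Vᵢᵀ`. -/
def gothicS : Matrix (Fin q) (Fin q) ℝ := Matrix.of fun j l =>
  (1 / (n : ℝ)) * ∑ i, deriv (deriv ρ) (looResidual ρ τ e X i) * firstEntries X i j *
    firstEntries X i l

/-- `(𝔖_p + τ Id)⁻¹ u_p`. -/
def wVec : Fin q → ℝ :=
  (gothicS ρ τ e X + τ • (1 : Matrix (Fin q) (Fin q) ℝ))⁻¹.mulVec (uVec ρ τ e X)

/-- `ξ_n = (1/n) ∑ᵢ Xᵢ(p)² ψ'(r_{i,[p]}) - u_pᵀ (𝔖_p + τ Id)⁻¹ u_p`. -/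
def xi : ℝ :=
  (1 / (n : ℝ)) * ∑ i, lastEntry X i ^ 2 * deriv (deriv ρ) (looResidual ρ τ e X i) -
    uVec ρ τ e X ⬝ᵥ wVec ρ τ e X

/-- `N_p = n^{-1/2} ∑ᵢ Xᵢ(p) ψ(r_{i,[p]})`. -/
def bigN : ℝ :=
  (1 / Real.sqrt n) * ∑ i, lastEntry X i * deriv ρ (looResidual ρ τ e X i)

/-- `𝔟_p = N_p / (√n (τ + ξ_n))`. -/
def gothicB : ℝ := bigN ρ τ e X / (Real.sqrt n * (τ + xi ρ τ e X))

/-- `b̃ = (γ̂, 0) + 𝔟_p (-(𝔖_p + τ Id)⁻¹ u_p, 1)`. -/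
def bTilde : EuclideanSpace ℝ (Fin (q + 1)) :=
  WithLp.toLp 2 (Fin.snoc (α := fun _ => ℝ) (fun j => gammaHat ρ τ e X j) 0) +
    gothicB ρ τ e X •
      WithLp.toLp 2 (Fin.snoc (α := fun _ => ℝ) (fun j => -wVec ρ τ e X j) 1)

end LeaveOnePredictorOut

/-! ### Orders of magnitude in `L_k` -/

/-- `Zₙ = O_{L_k}(polyLog(n) aₙ)` for every fixed `k`: there is a power `α` of the logarithm
such that, for every `k ≥ 1`, `(E|Zₙ|^k)^{1/k} ≤ K_k (log n)^α aₙ` for all large `n`. -/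
def BigOLk {Ω : ℕ → Type*} [∀ n, MeasurableSpace (Ω n)] (μ : ∀ n, Measure (Ω n))
    (Z : ∀ n, Ω n → ℝ) (a : ℕ → ℝ) : Prop :=
  (∀ n, AEStronglyMeasurable (Z n) (μ n)) ∧
    ∃ α : ℝ, ∀ k : ℕ, 1 ≤ k → ∃ K : ℝ, ∀ᶠ n : ℕ in atTop,
      eLpNorm (Z n) (k : ENNReal) (μ n) ≤ ENNReal.ofReal (K * Real.log n ^ α * a n)

/-! ### Assumptions -/

/-- Assumptions on the loss: `ρ` is twice differentiable, convex, non-linear, `ρ ≥ 0`, `ρ(0) = 0`;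
`ψ = ρ'` is `O(|x|^m)` at infinity, and `ψ'` is `L(u)`-Lipschitz on `(-u, u)` with
`L(u) ≤ K u^{m₁}` for large `u`. -/
structure LossAssumptions (ρ : ℝ → ℝ) : Prop where
  differentiable : Differentiable ℝ ρ
  differentiable_deriv : Differentiable ℝ (deriv ρ)
  convex : ConvexOn ℝ Set.univ ρ
  nonlinear : ¬ ∃ a : ℝ, ∀ x, ρ x = a * x
  nonneg : ∀ x, 0 ≤ ρ x
  map_zero : ρ 0 = 0
  growth : ∃ m : ℝ, deriv ρ =O[Bornology.cobounded ℝ] fun x => |x| ^ m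
  lipschitz : ∃ (L : ℝ → ℝ) (K m₁ : ℝ),
    (∀ u > 0, ∀ x ∈ Set.Ioo (-u) u, ∀ y ∈ Set.Ioo (-u) u,
      |deriv (deriv ρ) x - deriv (deriv ρ) y| ≤ L u * |x - y|) ∧
    ∀ᶠ u in atTop, L u ≤ K * u ^ m₁

/-- Concentration of convex Lipschitz functions: for every convex `1`-Lipschitz `F` there is a
deterministic centering `m_F` (such as the mean or a median of `F(Y)`) with
`P(|F(Y) - m_F| > t) ≤ C exp(-c t²)` for all `t > 0`. -/
def ConvexConcentration {Ω : Type*} [MeasurableSpace Ω] (μ : Measure Ω) {d : ℕ}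
    (Y : Ω → EuclideanSpace ℝ (Fin d)) (C c : ℝ) : Prop :=
  ∀ F : EuclideanSpace ℝ (Fin d) → ℝ, ConvexOn ℝ Set.univ F → LipschitzWith 1 F →
    ∃ m : ℝ, ∀ t > 0, μ.real {ω | t < |F (Y ω) - m|} ≤ C * Real.exp (-c * t ^ 2)

/-- Assumptions on the design for one sample size: the `Xᵢ` are i.i.d. random vectors with
i.i.d. entries, mean `0` and covariance `Id`, and satisfy the concentration property. -/
structure DesignAssumptions {Ω : Type*} [MeasurableSpace Ω] (μ : Measure Ω) {n d : ℕ}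
    (X : Fin n → Ω → EuclideanSpace ℝ (Fin d)) (C c : ℝ) : Prop where
  measurable : ∀ i, Measurable (X i)
  indep : iIndepFun X μ
  identDistrib : ∀ i i', IdentDistrib (X i) (X i') μ μ
  indep_entries : ∀ i, iIndepFun (fun (j : Fin d) ω => X i ω j) μ
  identDistrib_entries : ∀ i j j',
    IdentDistrib (fun ω => X i ω j) (fun ω => X i ω j') μ μ
  memLp_two : ∀ i j, MemLp (fun ω => X i ω j) 2 μ
  mean_zero : ∀ i j, ∫ ω, X i ω j ∂μ = 0
  cov_id : ∀ i j l, covariance (fun ω => X i ω j) (fun ω => X i ω l) μ = if j = l then 1 else 0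
  concentration : ∀ i, ConvexConcentration μ (X i) C c

end RidgeM

end

noncomputable section

namespace RidgeM

open MeasureTheory ProbabilityTheory Filter Topology

/-! ### Exponential moments of squares -/

section ExpSq

variable {Ω : Type*} [MeasurableSpace Ω] {μ : Measure Ω}

/-- `E exp(s Z²) ≤ M`. -/
def ExpSqBound (μ : Measure Ω) (Z : Ω → ℝ) (s M : ℝ) : Prop :=
  ∫⁻ ω, ENNReal.ofReal (Real.exp (s * Z ω ^ 2)) ∂μ ≤ ENNReal.ofReal M

theorem ExpSqBound.integrable {Z : Ω → ℝ} {s M : ℝ} (hZ : AEMeasurable Z μ)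
    (h : ExpSqBound μ Z s M) : Integrable (fun ω => Real.exp (s * Z ω ^ 2)) μ := by
  refine ⟨by fun_prop, ?_⟩
  rw [hasFiniteIntegral_iff_ofReal (ae_of_all _ fun ω => (Real.exp_pos _).le)]
  exact lt_of_le_of_lt h ENNReal.ofReal_lt_top

theorem ExpSqBound.integral_le {Z : Ω → ℝ} {s M : ℝ} (hM : 0 ≤ M) (hZ : AEMeasurable Z μ)
    (h : ExpSqBound μ Z s M) : ∫ ω, Real.exp (s * Z ω ^ 2) ∂μ ≤ M := by
  rw [integral_eq_lintegral_of_nonneg_ae (ae_of_all _ fun ω => (Real.exp_pos _).le) (by fun_prop)]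
  exact ENNReal.toReal_le_of_le_ofReal hM h

theorem expSqBound_of_integral_le {Z : Ω → ℝ} {s M : ℝ}
    (hi : Integrable (fun ω => Real.exp (s * Z ω ^ 2)) μ)
    (h : ∫ ω, Real.exp (s * Z ω ^ 2) ∂μ ≤ M) : ExpSqBound μ Z s M := by
  unfold ExpSqBound
  rw [← ofReal_integral_eq_lintegral_ofReal hi (ae_of_all _ fun ω => (Real.exp_pos _).le)]
  exact ENNReal.ofReal_le_ofReal h

theorem ExpSqBound.mono {Z Z' : Ω → ℝ} {s s' M M' : ℝ} (h : ExpSqBound μ Z s M)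
    (hZ : ∀ ω, s' * Z' ω ^ 2 ≤ s * Z ω ^ 2) (hM : M ≤ M') : ExpSqBound μ Z' s' M' :=
  (lintegral_mono fun ω => ENNReal.ofReal_le_ofReal (Real.exp_le_exp.2 (hZ ω))).trans
    (h.trans (ENNReal.ofReal_le_ofReal hM))

/-- Jensen's inequality: the parameter may be lowered at the price of a power of the bound. -/
theorem ExpSqBound.rpow [IsProbabilityMeasure μ] {Z : Ω → ℝ} {s M θ : ℝ} (hM : 0 ≤ M)
    (hs : 0 ≤ s) (hZ : AEMeasurable Z μ) (h : ExpSqBound μ Z s M) (h0 : 0 ≤ θ) (h1 : θ ≤ 1) :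
    ExpSqBound μ Z (θ * s) (M ^ θ) := by
  have hi := h.integrable hZ
  have he : ∀ ω, Real.exp (θ * s * Z ω ^ 2) = Real.exp (s * Z ω ^ 2) ^ θ := fun ω => by
    rw [← Real.exp_mul]; ring_nf
  have hi' : Integrable (fun ω => Real.exp (θ * s * Z ω ^ 2)) μ := by
    refine hi.mono' (by fun_prop) (ae_of_all _ fun ω => ?_)
    rw [Real.norm_eq_abs, abs_of_pos (Real.exp_pos _)]
    refine Real.exp_le_exp.2 (mul_le_mul_of_nonneg_right ?_ (sq_nonneg _))
    nlinarith
  refine expSqBound_of_integral_le hi' ?_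
  simp only [he] at hi' ⊢
  have := (Real.concaveOn_rpow h0 h1).le_map_integral (μ := μ)
    (f := fun ω => Real.exp (s * Z ω ^ 2))
    (Real.continuous_rpow_const h0).continuousOn isClosed_Ici
    (ae_of_all _ fun ω => (Real.exp_pos _).le) hi hi'
  exact this.trans (Real.rpow_le_rpow (integral_nonneg fun ω => (Real.exp_pos _).le)
    (h.integral_le hM hZ) h0)

theorem lintegral_Ioi_mul_exp_neg {s : ℝ} (hs : 0 < s) :
    ∫⁻ t in Set.Ioi (0 : ℝ), ENNReal.ofReal (2 * s * t * Real.exp (-s * t ^ 2)) = 1 := by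
  have hd : ∀ x ∈ Set.Ici (0 : ℝ), HasDerivAt (fun t : ℝ => -Real.exp (-s * t ^ 2))
      (2 * s * x * Real.exp (-s * x ^ 2)) x := fun x _ => by
    convert! (((hasDerivAt_pow 2 x).const_mul (-s)).exp).neg using 1
    simp; ring
  have hp : ∀ x ∈ Set.Ioi (0 : ℝ), 0 ≤ 2 * s * x * Real.exp (-s * x ^ 2) := fun x hx => by
    have : (0 : ℝ) < x := hx
    positivity
  have hl : Tendsto (fun t : ℝ => -Real.exp (-s * t ^ 2)) atTop (𝓝 (-0)) := by
    refine Tendsto.neg (Real.tendsto_exp_atBot.comp ?_)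
    exact (tendsto_pow_atTop two_ne_zero).const_mul_atTop_of_neg (by linarith)
  rw [← ofReal_integral_eq_lintegral_ofReal (integrableOn_Ioi_deriv_of_nonneg' hd hp hl)
    ((ae_restrict_iff' measurableSet_Ioi).2 (ae_of_all _ hp)),
    integral_Ioi_of_hasDerivAt_of_nonneg' hd hp hl]
  simp

theorem expSqBound_of_tail [IsProbabilityMeasure μ] {Z : Ω → ℝ} (hZ : Measurable Z) {s C : ℝ}
    (hs : 0 < s) (hC : 0 ≤ C)
    (h : ∀ t > 0, μ.real {ω | t < |Z ω|} ≤ C * Real.exp (-(2 * s) * t ^ 2)) :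
    ExpSqBound μ Z s (1 + C) := by
  set g : ℝ → ℝ := fun t => 2 * s * t * Real.exp (s * t ^ 2) with hg
  have hgc : Continuous g := by fun_prop
  have hint : ∀ z : ℝ, ∫ t in (0 : ℝ)..z, g t = Real.exp (s * z ^ 2) - 1 := fun z => by
    have hd : ∀ x ∈ Set.uIcc 0 z, HasDerivAt (fun t : ℝ => Real.exp (s * t ^ 2)) (g x) x :=
      fun x _ => by
        convert! ((hasDerivAt_pow 2 x).const_mul s).exp using 1
        simp [hg]; ring
    rw [intervalIntegral.integral_eq_sub_of_hasDerivAt hd (hgc.intervalIntegrable _ _)]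
    simp
  have hnn : ∀ z : ℝ, 0 ≤ Real.exp (s * z ^ 2) - 1 := fun z => by
    have := Real.add_one_le_exp (s * z ^ 2)
    nlinarith [mul_nonneg hs.le (sq_nonneg z)]
  have hlc := lintegral_comp_eq_lintegral_meas_lt_mul μ (f := fun ω => |Z ω|)
    (ae_of_all _ fun ω => abs_nonneg _) (by fun_prop)
    (fun t _ => hgc.intervalIntegrable 0 t)
    ((ae_restrict_iff' measurableSet_Ioi).2 (ae_of_all _ fun t ht => by
      have : (0 : ℝ) < t := ht
      simp only [hg]; positivity))
  simp only [hint, sq_abs] at hlc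
  have hle : ∫⁻ t in Set.Ioi (0 : ℝ), μ {a | t < |Z a|} * ENNReal.ofReal (g t) ≤
      ENNReal.ofReal C := by
    calc _ ≤ ∫⁻ t in Set.Ioi (0 : ℝ), ENNReal.ofReal C *
          ENNReal.ofReal (2 * s * t * Real.exp (-s * t ^ 2)) := by
          refine setLIntegral_mono (by fun_prop) fun t ht => ?_
          have ht' : (0 : ℝ) < t := ht
          have h1 : μ {a | t < |Z a|} ≤ ENNReal.ofReal (C * Real.exp (-(2 * s) * t ^ 2)) := by
            rw [← ENNReal.ofReal_toReal (measure_ne_top μ {a | t < |Z a|})]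
            exact ENNReal.ofReal_le_ofReal (h t ht')
          calc _ ≤ ENNReal.ofReal (C * Real.exp (-(2 * s) * t ^ 2)) * ENNReal.ofReal (g t) := by
                gcongr
            _ = _ := by
                rw [← ENNReal.ofReal_mul (by positivity), ← ENNReal.ofReal_mul hC]
                congr 1
                have : Real.exp (-(2 * s) * t ^ 2) * Real.exp (s * t ^ 2) =
                    Real.exp (-s * t ^ 2) := by
                  rw [← Real.exp_add]; ring_nf
                rw [← this, hg]; ring
      _ = _ := by
          rw [lintegral_const_mul _ (by fun_prop), lintegral_Ioi_mul_exp_neg hs, mul_one]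
  unfold ExpSqBound
  calc _ = ∫⁻ ω, (1 + ENNReal.ofReal (Real.exp (s * Z ω ^ 2) - 1)) ∂μ := by
        refine lintegral_congr fun ω => ?_
        rw [← ENNReal.ofReal_one, ← ENNReal.ofReal_add zero_le_one (hnn _)]
        congr 1; ring
    _ ≤ 1 + ENNReal.ofReal C := by
        rw [lintegral_add_left measurable_const, hlc]
        simpa using hle
    _ = _ := by rw [← ENNReal.ofReal_one, ENNReal.ofReal_add zero_le_one hC]

theorem exp_le_add_exp_sq (x : ℝ) : Real.exp x ≤ x + Real.exp (x ^ 2) := by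
  have h1 := Real.add_one_le_exp (x ^ 2)
  rcases le_or_gt |x| 1 with h | h
  · have := (abs_le.1 (Real.abs_exp_sub_one_sub_id_le h)).2
    linarith
  · rcases lt_abs.1 h with h | h
    · have : Real.exp x ≤ Real.exp (x ^ 2) := Real.exp_le_exp.2 (by nlinarith)
      linarith
    · have : Real.exp x ≤ 1 := Real.exp_le_one_iff.2 (by linarith)
      nlinarith

theorem ExpSqBound.integrable_exp_mul {Z : Ω → ℝ} {s M : ℝ} (hs : 0 < s)
    (hZ : AEMeasurable Z μ) (h : ExpSqBound μ Z s M) (t : ℝ) :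
    Integrable (fun ω => Real.exp (t * Z ω)) μ := by
  refine ((h.integrable hZ).const_mul (Real.exp (t ^ 2 / (4 * s)))).mono' (by fun_prop)
    (ae_of_all _ fun ω => ?_)
  rw [Real.norm_eq_abs, abs_of_pos (Real.exp_pos _), ← Real.exp_add]
  refine Real.exp_le_exp.2 ?_
  have : t ^ 2 / (4 * s) + s * Z ω ^ 2 - t * Z ω = s * (Z ω - t / (2 * s)) ^ 2 := by
    field_simp; ring
  nlinarith [mul_nonneg hs.le (sq_nonneg (Z ω - t / (2 * s)))]

theorem ExpSqBound.hasSubgaussianMGF [IsProbabilityMeasure μ] {Z : Ω → ℝ} {s M : ℝ}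
    (hs : 0 < s) (hM : 1 ≤ M) (hZ : AEMeasurable Z μ) (hint : Integrable Z μ)
    (h0 : ∫ ω, Z ω ∂μ = 0) (h : ExpSqBound μ Z s M) :
    HasSubgaussianMGF Z (Real.toNNReal (2 * (1 + Real.log M) / s)) μ := by
  have hlog : 0 ≤ Real.log M := Real.log_nonneg hM
  refine ⟨h.integrable_exp_mul hs hZ, fun t => ?_⟩
  rw [Real.coe_toNNReal _ (by positivity)]
  have hgoal : ∀ x, x ≤ t ^ 2 / s * (1 + Real.log M) →
      Real.exp x ≤ Real.exp (2 * (1 + Real.log M) / s * t ^ 2 / 2) := fun x hx => by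
    refine Real.exp_le_exp.2 (hx.trans (le_of_eq ?_))
    field_simp
  rcases le_or_gt (t ^ 2) s with hts | hts
  · have hr := h.rpow (by linarith) hs.le hZ (θ := t ^ 2 / s) (by positivity)
      ((div_le_one hs).2 hts)
    rw [div_mul_cancel₀ _ hs.ne'] at hr
    have h2 : ∫ ω, Real.exp (t * Z ω) ∂μ ≤ ∫ ω, (t * Z ω + Real.exp (t ^ 2 * Z ω ^ 2)) ∂μ := by
      refine integral_mono (h.integrable_exp_mul hs hZ t)
        ((hint.const_mul t).add (hr.integrable hZ)) fun ω => ?_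
      have := exp_le_add_exp_sq (t * Z ω)
      rwa [mul_pow] at this
    rw [integral_add (hint.const_mul t) (hr.integrable hZ), integral_const_mul, h0, mul_zero,
      zero_add] at h2
    refine (h2.trans (hr.integral_le (by positivity) hZ)).trans ?_
    rw [Real.rpow_def_of_pos (by linarith)]
    refine hgoal _ ?_
    have : 0 ≤ t ^ 2 / s := by positivity
    nlinarith
  · have h2 : ∫ ω, Real.exp (t * Z ω) ∂μ ≤
        ∫ ω, Real.exp (t ^ 2 / s) * Real.exp (s * Z ω ^ 2) ∂μ := by
      refine integral_mono (h.integrable_exp_mul hs hZ t)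
        ((h.integrable hZ).const_mul _) fun ω => ?_
      simp only
      rw [← Real.exp_add]
      refine Real.exp_le_exp.2 ?_
      have h3 : t ^ 2 / s + s * Z ω ^ 2 - t * Z ω =
          s * (Z ω - t / (2 * s)) ^ 2 + 3 / 4 * (t ^ 2 / s) := by
        field_simp; ring
      have h4 : 0 ≤ t ^ 2 / s := by positivity
      nlinarith [mul_nonneg hs.le (sq_nonneg (Z ω - t / (2 * s)))]
    rw [integral_const_mul] at h2
    have h5 := h.integral_le (by linarith) hZ
    refine h2.trans ((mul_le_mul_of_nonneg_left h5 (Real.exp_pos _).le).trans ?_)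
    rw [← Real.exp_log (show 0 < M by linarith), ← Real.exp_add, Real.log_exp]
    refine hgoal _ ?_
    have : 1 ≤ t ^ 2 / s := (one_le_div hs).2 hts.le
    nlinarith

/-- A centered variable of unit variance that concentrates around some point is sub-Gaussian. -/
theorem hasSubgaussianMGF_of_concentration [IsProbabilityMeasure μ] {Y : Ω → ℝ}
    (hY : Measurable Y) (hL2 : MemLp Y 2 μ) (h0 : ∫ ω, Y ω ∂μ = 0) {m C c : ℝ}
    (hc : 0 < c) (hC : 0 ≤ C)
    (h : ∀ t > 0, μ.real {ω | t < |Y ω - m|} ≤ C * Real.exp (-c * t ^ 2)) :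
    HasSubgaussianMGF Y (Real.toNNReal (2 * (1 + Real.log ((1 + C) ^ 2)) / (c / 4))) μ := by
  have hint : Integrable Y μ := hL2.integrable one_le_two
  have hm : ExpSqBound μ (fun ω => Y ω - m) (c / 2) (1 + C) :=
    expSqBound_of_tail (by fun_prop) (by positivity) hC fun t ht => by
      convert h t ht using 4; ring
  have hmi := hm.integrable (by fun_prop)
  have hm2 : Real.exp (c / 2 * m ^ 2) ≤ 1 + C := by
    have h1 : ∫ ω, Real.exp (c / 2 * m ^ 2) * (1 - c * m * Y ω) ∂μ ≤
        ∫ ω, Real.exp (c / 2 * (Y ω - m) ^ 2) ∂μ := by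
      refine integral_mono (by fun_prop) hmi fun ω => ?_
      simp only
      have h3 := Real.add_one_le_exp (-(c * m * Y ω))
      calc _ ≤ Real.exp (c / 2 * m ^ 2) * Real.exp (-(c * m * Y ω)) := by
            refine mul_le_mul_of_nonneg_left (by linarith) (Real.exp_pos _).le
        _ ≤ _ := by
            rw [← Real.exp_add]
            refine Real.exp_le_exp.2 ?_
            nlinarith [mul_nonneg hc.le (sq_nonneg (Y ω))]
    rw [integral_const_mul, integral_sub (by fun_prop) (by fun_prop), integral_const_mul, h0] at h1
    simp only [integral_const, probReal_univ, smul_eq_mul, mul_one, mul_zero, sub_zero] at h1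
    exact h1.trans (hm.integral_le (by linarith) (by fun_prop))
  have hYb : ExpSqBound μ Y (c / 4) ((1 + C) ^ 2) := by
    unfold ExpSqBound
    calc _ ≤ ∫⁻ ω, ENNReal.ofReal (Real.exp (c / 2 * m ^ 2)) *
          ENNReal.ofReal (Real.exp (c / 2 * (Y ω - m) ^ 2)) ∂μ := by
          refine lintegral_mono fun ω => ?_
          rw [← ENNReal.ofReal_mul (Real.exp_pos _).le, ← Real.exp_add]
          refine ENNReal.ofReal_le_ofReal (Real.exp_le_exp.2 ?_)
          nlinarith [mul_nonneg hc.le (sq_nonneg (Y ω - 2 * m))]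
      _ ≤ ENNReal.ofReal (1 + C) * ENNReal.ofReal (1 + C) := by
          rw [lintegral_const_mul _ (by fun_prop)]
          exact mul_le_mul' (ENNReal.ofReal_le_ofReal hm2) hm
      _ = _ := by rw [← ENNReal.ofReal_mul (by linarith), sq]
  refine hYb.hasSubgaussianMGF (by positivity) ?_ hY.aemeasurable hint h0
  nlinarith

theorem _root_.ProbabilityTheory.HasSubgaussianMGF.expSqBound [IsProbabilityMeasure μ]
    {Z : Ω → ℝ} (hZ : Measurable Z) {σ : NNReal} (hσ : 0 < σ) (h : HasSubgaussianMGF Z σ μ) :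
    ExpSqBound μ Z (1 / (4 * σ)) 3 := by
  have hσ' : (0 : ℝ) < σ := hσ
  have := expSqBound_of_tail (μ := μ) hZ (s := 1 / (4 * σ)) (C := 2) (by positivity) (by norm_num)
    fun t ht => by
      have h1 := h.measure_ge_le ht.le
      have h2 := h.neg.measure_ge_le ht.le
      have h3 : {ω | t < |Z ω|} ⊆ {ω | t ≤ Z ω} ∪ {ω | t ≤ (-Z) ω} := fun ω hω => by
        rcases lt_abs.1 (show t < |Z ω| from hω) with h | h
        · exact Or.inl h.le
        · exact Or.inr h.le
      refine (measureReal_mono h3).trans ((measureReal_union_le _ _).trans ?_)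
      have h4 : -t ^ 2 / (2 * (σ : ℝ)) = -(2 * (1 / (4 * (σ : ℝ)))) * t ^ 2 := by
        field_simp; ring
      rw [h4] at h1 h2
      linarith
  exact this.mono (fun _ => le_rfl) (by norm_num)

theorem _root_.ProbabilityTheory.HasSubgaussianMGF.mono_param {Z : Ω → ℝ} {σ σ' : NNReal}
    (h : HasSubgaussianMGF Z σ μ) (hσ : σ ≤ σ') : HasSubgaussianMGF Z σ' μ :=
  ⟨h.integrable_exp_mul, fun t => (h.mgf_le t).trans (Real.exp_le_exp.2 (by
    have : (σ : ℝ) ≤ σ' := hσ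
    gcongr))⟩

/-- Normalized linear combinations of independent sub-Gaussian variables. -/
theorem expSqBound_sum_mul [IsProbabilityMeasure μ] {ι : Type*} [Fintype ι] {Y : ι → Ω → ℝ}
    (hY : ∀ j, Measurable (Y j)) (hind : iIndepFun Y μ) {σ : NNReal} (hσ : 0 < σ)
    (h : ∀ j, HasSubgaussianMGF (Y j) σ μ) (a : ι → ℝ) (ha : ∑ j, a j ^ 2 ≤ 1) :
    ExpSqBound μ (fun ω => ∑ j, a j * Y j ω) (1 / (4 * σ)) 3 := by
  have h1 := HasSubgaussianMGF.sum_of_iIndepFun (μ := μ) (X := fun j ω => a j * Y j ω)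
    (hind.comp (fun j x => a j * x) fun j => by fun_prop) (s := Finset.univ)
    (fun j _ => (h j).const_mul (a j))
  refine (h1.mono_param (σ' := σ) ?_).expSqBound (by fun_prop) hσ
  refine NNReal.coe_le_coe.1 ?_
  rw [NNReal.coe_sum]
  calc _ = ∑ j, a j ^ 2 * (σ : ℝ) := Finset.sum_congr rfl fun _ _ => rfl
    _ ≤ _ := by
        rw [← Finset.sum_mul]
        exact mul_le_of_le_one_left σ.2 ha

/-- Freezing an independent variable. -/
theorem expSqBound_of_indepFun [IsProbabilityMeasure μ] {F G : Type*} [MeasurableSpace F]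
    [MeasurableSpace G] {W : Ω → G} {Y : Ω → F} (hW : Measurable W) (hY : Measurable Y)
    (hind : IndepFun W Y μ) {h : G → F → ℝ} (hh : Measurable (Function.uncurry h)) {s M : ℝ}
    (hb : ∀ g, ExpSqBound μ (fun ω => h g (Y ω)) s M) :
    ExpSqBound μ (fun ω => h (W ω) (Y ω)) s M := by
  unfold ExpSqBound at hb ⊢
  have hmeas : Measurable fun z : G × F => ENNReal.ofReal (Real.exp (s * h z.1 z.2 ^ 2)) := by
    have : Measurable fun z : G × F => h z.1 z.2 := hh
    fun_prop
  have := Measure.isProbabilityMeasure_map (μ := μ) hW.aemeasurable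
  have := Measure.isProbabilityMeasure_map (μ := μ) hY.aemeasurable
  calc _ = ∫⁻ z, ENNReal.ofReal (Real.exp (s * h z.1 z.2 ^ 2)) ∂(μ.map fun ω => (W ω, Y ω)) := by
        rw [lintegral_map hmeas (by fun_prop)]
    _ = ∫⁻ g, ∫⁻ y, ENNReal.ofReal (Real.exp (s * h g y ^ 2)) ∂(μ.map Y) ∂(μ.map W) := by
        rw [(indepFun_iff_map_prod_eq_prod_map_map hW.aemeasurable hY.aemeasurable).1 hind,
          lintegral_prod _ hmeas.aemeasurable]
    _ ≤ ∫⁻ _, ENNReal.ofReal M ∂(μ.map W) := by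
        refine lintegral_mono fun g => ?_
        have hg : Measurable fun y => ENNReal.ofReal (Real.exp (s * h g y ^ 2)) :=
          hmeas.comp measurable_prodMk_left
        rw [lintegral_map hg hY]
        exact hb g
    _ = _ := by simp

theorem expSqBound_iSup_abs [IsProbabilityMeasure μ] {ι : Type*} [Fintype ι] {Z : ι → Ω → ℝ}
    (hZ : ∀ i, Measurable (Z i)) {s M : ℝ} (hM : 0 ≤ M) (h : ∀ i, ExpSqBound μ (Z i) s M) :
    ExpSqBound μ (fun ω => ⨆ i, |Z i ω|) s (1 + Fintype.card ι * M) := by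
  unfold ExpSqBound at h ⊢
  calc _ ≤ ∫⁻ ω, (1 + ∑ i, ENNReal.ofReal (Real.exp (s * Z i ω ^ 2))) ∂μ := by
        refine lintegral_mono fun ω => ?_
        rcases isEmpty_or_nonempty ι with hι | hι
        · simp
        · obtain ⟨i, hi⟩ := exists_eq_ciSup_of_finite (f := fun i => |Z i ω|)
          simp only
          rw [← hi, sq_abs]
          exact (Finset.single_le_sum (f := fun i => ENNReal.ofReal (Real.exp (s * Z i ω ^ 2)))
            (fun _ _ => zero_le) (Finset.mem_univ i)).trans le_add_self
    _ = 1 + ∑ i, ∫⁻ ω, ENNReal.ofReal (Real.exp (s * Z i ω ^ 2)) ∂μ := by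
        rw [lintegral_add_left measurable_const, lintegral_finsetSum _ (fun i _ => by fun_prop)]
        simp
    _ ≤ 1 + ∑ _i : ι, ENNReal.ofReal M := by gcongr with i; exact h i
    _ = _ := by
        rw [ENNReal.ofReal_add zero_le_one (by positivity), ENNReal.ofReal_mul (by positivity)]
        simp

end ExpSq

/-! ### Calculus of polylogarithmic sequences -/

theorem eventually_one_le_log : ∀ᶠ n : ℕ in atTop, 1 ≤ Real.log n :=
  (Real.tendsto_log_atTop.comp tendsto_natCast_atTop_atTop).eventually_ge_atTop 1

theorem rpow_le_pow_natCeil {x : ℝ} (hx : 1 ≤ x) (α : ℝ) : x ^ α ≤ x ^ ⌈α⌉₊ := by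
  rw [← Real.rpow_natCast]
  exact Real.rpow_le_rpow_of_exponent_le hx (Nat.le_ceil α)

theorem ExpSqBound.eLpNorm_le {Ω : Type*} [MeasurableSpace Ω] {μ : Measure Ω}
    [IsProbabilityMeasure μ] {Z : Ω → ℝ} (hZ : AEStronglyMeasurable Z μ) {t T : ℝ} (ht : 0 < t)
    (hT : 1 ≤ T) (htT : 1 ≤ t * T) (h : ExpSqBound μ Z t 3) {k : ℕ} (hk : 1 ≤ k) :
    eLpNorm Z k μ ≤ ENNReal.ofReal (3 * k.factorial * T) := by
  have hf : (1 : ℝ) ≤ k.factorial := mod_cast k.factorial_pos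
  have h2k : ((2 * k : ℕ) : ENNReal) ≠ 0 := by simp; omega
  refine (eLpNorm_le_eLpNorm_of_exponent_le (q := ((2 * k : ℕ) : ENNReal))
    (by exact_mod_cast (by omega : k ≤ 2 * k)) hZ).trans ?_
  rw [eLpNorm_eq_lintegral_rpow_enorm_toReal h2k (ENNReal.natCast_ne_top _), ENNReal.toReal_natCast]
  have hb : ∫⁻ ω, ‖Z ω‖ₑ ^ ((2 * k : ℕ) : ℝ) ∂μ ≤
      ENNReal.ofReal (3 * k.factorial * T) ^ ((2 * k : ℕ) : ℝ) := by
    calc _ ≤ ∫⁻ ω, ENNReal.ofReal (k.factorial * T ^ k) *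
          ENNReal.ofReal (Real.exp (t * Z ω ^ 2)) ∂μ := by
          refine lintegral_mono fun ω => ?_
          rw [ENNReal.rpow_natCast, Real.enorm_eq_ofReal_abs, ← ENNReal.ofReal_pow (abs_nonneg _),
            ← ENNReal.ofReal_mul (by positivity)]
          refine ENNReal.ofReal_le_ofReal ?_
          rw [pow_mul, sq_abs]
          have h1 := Real.pow_div_factorial_le_exp (t * Z ω ^ 2) (by positivity) k
          rw [div_le_iff₀ (by positivity)] at h1
          calc (Z ω ^ 2) ^ k ≤ (t * T) ^ k * (Z ω ^ 2) ^ k :=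
                le_mul_of_one_le_left (by positivity) (one_le_pow₀ htT)
            _ = T ^ k * (t * Z ω ^ 2) ^ k := by rw [← mul_pow, ← mul_pow]; ring
            _ ≤ T ^ k * (Real.exp (t * Z ω ^ 2) * k.factorial) := by gcongr
            _ = _ := by ring
      _ ≤ ENNReal.ofReal (k.factorial * T ^ k) * ENNReal.ofReal 3 := by
          rw [lintegral_const_mul' _ _ ENNReal.ofReal_ne_top]
          exact mul_le_mul_right h _
      _ ≤ _ := by
          rw [ENNReal.rpow_natCast, ← ENNReal.ofReal_pow (by positivity),
            ← ENNReal.ofReal_mul (by positivity)]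
          refine ENNReal.ofReal_le_ofReal ?_
          have h1 : T ^ k ≤ T ^ (2 * k) := pow_le_pow_right₀ hT (by omega)
          have h2 : (3 * k.factorial : ℝ) ≤ (3 * k.factorial) ^ (2 * k) :=
            le_self_pow₀ (by linarith) (by omega)
          rw [mul_pow (3 * (k.factorial : ℝ)) T]
          calc _ = (3 * k.factorial : ℝ) * T ^ k := by ring
            _ ≤ _ := by gcongr
  calc _ ≤ (ENNReal.ofReal (3 * k.factorial * T) ^ ((2 * k : ℕ) : ℝ)) ^ (1 / ((2 * k : ℕ) : ℝ)) :=
        ENNReal.rpow_le_rpow hb (by positivity)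
    _ = _ := by
        rw [← ENNReal.rpow_mul, mul_one_div_cancel, ENNReal.rpow_one]
        exact_mod_cast (by omega : 2 * k ≠ 0)

section Algebra

variable {Ω : ℕ → Type*} [∀ n, MeasurableSpace (Ω n)] {μ : ∀ n, Measure (Ω n)}

/-- `Zₙ = O_{L_k}(polyLog(n))`. -/
abbrev PolyLog (μ : ∀ n, Measure (Ω n)) (Z : ∀ n, Ω n → ℝ) : Prop := BigOLk μ Z fun _ => 1

theorem polyLog_of_pow {Z : ∀ n, Ω n → ℝ} (hZ : ∀ n, AEStronglyMeasurable (Z n) (μ n)) (a : ℕ)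
    (h : ∀ k : ℕ, 1 ≤ k → ∃ K : ℝ, ∀ᶠ n : ℕ in atTop,
      eLpNorm (Z n) (k : ENNReal) (μ n) ≤ ENNReal.ofReal (K * Real.log n ^ a)) : PolyLog μ Z := by
  refine ⟨hZ, a, fun k hk => ?_⟩
  simpa using h k hk

theorem PolyLog.exists_pow {Z : ∀ n, Ω n → ℝ} (h : PolyLog μ Z) :
    ∃ a : ℕ, ∀ k : ℕ, 1 ≤ k → ∃ K : ℝ, 0 ≤ K ∧ ∀ᶠ n : ℕ in atTop,
      eLpNorm (Z n) (k : ENNReal) (μ n) ≤ ENNReal.ofReal (K * Real.log n ^ a) := by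
  obtain ⟨_, α, h⟩ := h
  refine ⟨⌈α⌉₊, fun k hk => ?_⟩
  obtain ⟨K, hK⟩ := h k hk
  refine ⟨|K|, abs_nonneg _, ?_⟩
  filter_upwards [hK, eventually_one_le_log] with n hn hl
  refine hn.trans (ENNReal.ofReal_le_ofReal ?_)
  rw [mul_one]
  have : 0 ≤ Real.log n ^ α := Real.rpow_nonneg (by linarith) _
  calc K * Real.log n ^ α ≤ |K| * Real.log n ^ α := by gcongr; exact le_abs_self K
    _ ≤ _ := by gcongr; exact rpow_le_pow_natCeil hl α

theorem polyLog_of_expSq [∀ n, IsProbabilityMeasure (μ n)] {Z : ∀ n, Ω n → ℝ}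
    (hZ : ∀ n, AEStronglyMeasurable (Z n) (μ n)) (a : ℕ) (A : ℝ)
    (h : ∀ᶠ n : ℕ in atTop, ∃ s M : ℝ, 0 < s ∧ 1 ≤ M ∧ ExpSqBound (μ n) (Z n) s M ∧
      1 / s ≤ A * Real.log n ^ a ∧ Real.log M ≤ A * Real.log n) : PolyLog μ Z := by
  refine polyLog_of_pow hZ (a + 1) fun k hk => ⟨3 * k.factorial * (1 + |A|) ^ 2, ?_⟩
  filter_upwards [h, eventually_one_le_log] with n ⟨s, M, hs, hM, hb, h1, h2⟩ hl
  have hlM : 0 ≤ Real.log M := Real.log_nonneg hM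
  set θ : ℝ := 1 / (1 + Real.log M) with hθ
  have hθ0 : 0 < θ := by positivity
  have hb' := hb.rpow (by linarith) hs.le (hZ n).aemeasurable hθ0.le
    ((div_le_one (by positivity)).2 (by linarith))
  have hM3 : M ^ θ ≤ 3 := by
    rw [Real.rpow_def_of_pos (by linarith)]
    refine le_trans (Real.exp_le_exp.2 ?_) Real.exp_one_lt_three.le
    rw [hθ, mul_one_div]
    exact (div_le_one (by positivity)).2 (by linarith)
  have hA : A ≤ |A| := le_abs_self A
  have hT : 1 / (θ * s) ≤ (1 + |A|) ^ 2 * Real.log n ^ (a + 1) := by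
    have h3 : 1 / s ≤ (1 + |A|) * Real.log n ^ a :=
      h1.trans (by gcongr; linarith)
    have h4 : 1 + Real.log M ≤ (1 + |A|) * Real.log n := by
      nlinarith [mul_le_mul_of_nonneg_right hA (by linarith : 0 ≤ Real.log n)]
    calc 1 / (θ * s) = (1 + Real.log M) * (1 / s) := by rw [hθ]; field_simp
      _ ≤ ((1 + |A|) * Real.log n) * ((1 + |A|) * Real.log n ^ a) := by gcongr
      _ = _ := by ring
  refine ((hb'.mono (fun _ => le_rfl) hM3).eLpNorm_le (hZ n)
    (T := (1 + |A|) ^ 2 * Real.log n ^ (a + 1)) (by positivity) ?_ ?_ hk).trans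
    (le_of_eq (congrArg ENNReal.ofReal ?_))
  · have : (1 : ℝ) ≤ (1 + |A|) ^ 2 := one_le_pow₀ (by linarith [abs_nonneg A])
    exact one_le_mul_of_one_le_of_one_le this (one_le_pow₀ hl)
  · rwa [div_le_iff₀ (by positivity), mul_comm] at hT
  · ring

theorem BigOLk.of_le {Z Y : ∀ n, Ω n → ℝ} {a : ℕ → ℝ}
    (hZ : ∀ n, AEStronglyMeasurable (Z n) (μ n)) (hY : PolyLog μ Y) (ha : ∀ n, 0 ≤ a n)
    (h : ∀ᶠ n in atTop, ∀ ω, |Z n ω| ≤ Y n ω * a n) : BigOLk μ Z a := by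
  obtain ⟨_, α, hα⟩ := hY
  refine ⟨hZ, α, fun k hk => ?_⟩
  obtain ⟨K, hK⟩ := hα k hk
  refine ⟨K, ?_⟩
  filter_upwards [hK, h] with n h1 h2
  calc eLpNorm (Z n) k (μ n) ≤ eLpNorm (a n • Y n) k (μ n) :=
        eLpNorm_mono_real fun ω => by
          simpa [mul_comm] using h2 ω
    _ = ENNReal.ofReal (a n) * eLpNorm (Y n) k (μ n) := by
        rw [eLpNorm_const_smul, Real.enorm_eq_ofReal (ha n)]
    _ ≤ ENNReal.ofReal (a n) * ENNReal.ofReal (K * Real.log n ^ α * 1) := by gcongr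
    _ = _ := by rw [← ENNReal.ofReal_mul (ha n)]; congr 1; ring

theorem PolyLog.const [∀ n, IsProbabilityMeasure (μ n)] (c : ℝ) :
    PolyLog μ fun _ _ => c := by
  refine polyLog_of_pow (fun n => aestronglyMeasurable_const) 0 fun k hk => ⟨|c|, ?_⟩
  refine Eventually.of_forall fun n => ?_
  rw [eLpNorm_const _ (by simp; omega) (IsProbabilityMeasure.ne_zero (μ n))]
  simp [Real.enorm_eq_ofReal_abs]

theorem PolyLog.add {Y Z : ∀ n, Ω n → ℝ} (hY : PolyLog μ Y) (hZ : PolyLog μ Z) :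
    PolyLog μ fun n ω => Y n ω + Z n ω := by
  obtain ⟨a, ha⟩ := hY.exists_pow
  obtain ⟨b, hb⟩ := hZ.exists_pow
  refine polyLog_of_pow (fun n => (hY.1 n).add (hZ.1 n)) (a + b) fun k hk => ?_
  obtain ⟨K, hK0, hK⟩ := ha k hk
  obtain ⟨L, hL0, hL⟩ := hb k hk
  refine ⟨K + L, ?_⟩
  filter_upwards [hK, hL, eventually_one_le_log] with n h1 h2 hl
  refine (eLpNorm_add_le (hY.1 n) (hZ.1 n) (by exact_mod_cast hk)).trans ?_
  refine (add_le_add h1 h2).trans ?_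
  rw [← ENNReal.ofReal_add (by positivity) (by positivity)]
  refine ENNReal.ofReal_le_ofReal ?_
  rw [add_mul]
  exact add_le_add (mul_le_mul_of_nonneg_left (pow_le_pow_right₀ hl (by omega)) hK0)
    (mul_le_mul_of_nonneg_left (pow_le_pow_right₀ hl (by omega)) hL0)

theorem PolyLog.mul {Y Z : ∀ n, Ω n → ℝ} (hY : PolyLog μ Y) (hZ : PolyLog μ Z) :
    PolyLog μ fun n ω => Y n ω * Z n ω := by
  obtain ⟨a, ha⟩ := hY.exists_pow
  obtain ⟨b, hb⟩ := hZ.exists_pow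
  refine polyLog_of_pow (fun n => (hY.1 n).mul (hZ.1 n)) (a + b) fun k hk => ?_
  obtain ⟨K, hK0, hK⟩ := ha (2 * k) (by omega)
  obtain ⟨L, hL0, hL⟩ := hb (2 * k) (by omega)
  refine ⟨K * L, ?_⟩
  filter_upwards [hK, hL, eventually_one_le_log] with n h1 h2 hl
  have : ENNReal.HolderTriple ((2 * k : ℕ) : ENNReal) ((2 * k : ℕ) : ENNReal) (k : ENNReal) := by
    refine ⟨?_⟩
    push_cast
    rw [ENNReal.mul_inv (by simp) (by simp), ← two_mul, ← mul_assoc,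
      ENNReal.mul_inv_cancel (by simp) (by simp), one_mul]
  refine (eLpNorm_smul_le_mul_eLpNorm (hZ.1 n) (hY.1 n) (p := ((2 * k : ℕ) : ENNReal))
    (q := ((2 * k : ℕ) : ENNReal)) (r := (k : ENNReal))).trans ?_
  refine (mul_le_mul' h1 h2).trans ?_
  rw [← ENNReal.ofReal_mul (by positivity)]
  exact ENNReal.ofReal_le_ofReal (le_of_eq (by ring))

theorem PolyLog.pow [∀ n, IsProbabilityMeasure (μ n)] {Y : ∀ n, Ω n → ℝ} (hY : PolyLog μ Y)
    (m : ℕ) : PolyLog μ fun n ω => Y n ω ^ m := by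
  induction m with
  | zero => simpa using PolyLog.const (μ := μ) 1
  | succ m ih => simpa [pow_succ] using ih.mul hY

end Algebra

/-! ### Consequences of the assumptions on the loss -/

/-- Polynomial bounds for a loss and its derivatives on `[-M, M]`. -/
structure LossBounds (ρ : ℝ → ℝ) (K : ℝ) (m : ℕ) : Prop where
  nonneg : 0 ≤ K
  lipschitz : ∀ M : ℝ, 1 ≤ M → ∀ x y : ℝ, |x| ≤ M → |y| ≤ M →
    |deriv (deriv ρ) x - deriv (deriv ρ) y| ≤ K * M ^ m * |x - y|
  deriv2_le : ∀ M : ℝ, 1 ≤ M → ∀ x : ℝ, |x| ≤ M → |deriv (deriv ρ) x| ≤ K * M ^ m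
  deriv_le : ∀ M : ℝ, 1 ≤ M → ∀ x : ℝ, |x| ≤ M → |deriv ρ x| ≤ K * M ^ m
  loss_le : ∀ M : ℝ, 1 ≤ M → ∀ x : ℝ, |x| ≤ M → ρ x ≤ K * M ^ m

theorem abs_sub_le_of_deriv_le_Icc {f : ℝ → ℝ} (hf : Differentiable ℝ f) {M B : ℝ}
    (h : ∀ x, |x| ≤ M → |deriv f x| ≤ B) {x y : ℝ} (hx : |x| ≤ M) (hy : |y| ≤ M) :
    |f y - f x| ≤ B * |y - x| :=
  (convex_Icc (-M) M).norm_image_sub_le_of_norm_deriv_le (fun z _ => hf z)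
    (fun z hz => h z (abs_le.2 hz)) (abs_le.1 hx) (abs_le.1 hy)

namespace LossAssumptions

variable {ρ : ℝ → ℝ} (hρ : LossAssumptions ρ)
include hρ

theorem continuous : Continuous ρ := hρ.differentiable.continuous

theorem continuous_deriv : Continuous (deriv ρ) := hρ.differentiable_deriv.continuous

theorem deriv_zero : deriv ρ 0 = 0 :=
  IsLocalMin.deriv_eq_zero (Eventually.of_forall fun x => by
    rw [hρ.map_zero]; exact hρ.nonneg x)

theorem monotone_deriv : Monotone (deriv ρ) := fun x y hxy =>
  hρ.convex.monotoneOn_deriv (fun x _ => hρ.differentiable x) (Set.mem_univ x) (Set.mem_univ y) hxy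

theorem deriv2_nonneg (x : ℝ) : 0 ≤ deriv (deriv ρ) x := hρ.monotone_deriv.deriv_nonneg

theorem exists_lossBounds : ∃ K m, LossBounds ρ K m := by
  obtain ⟨L, K₀, m₁, hL, hLu⟩ := hρ.lipschitz
  obtain ⟨u₀, hu₀⟩ := eventually_atTop.1 hLu
  set m := ⌈m₁⌉₊
  set K₁ := |K₀| * (2 + |u₀|) ^ m with hK₁
  have hK₁0 : 0 ≤ K₁ := by positivity
  have h1 : ∀ M : ℝ, 1 ≤ M → ∀ x y : ℝ, |x| ≤ M → |y| ≤ M →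
      |deriv (deriv ρ) x - deriv (deriv ρ) y| ≤ K₁ * M ^ m * |x - y| := by
    intro M hM x y hx hy
    set u := (2 + |u₀|) * M with hu
    have hu0 := abs_nonneg u₀
    have hu1 : M < u := by nlinarith
    have hu2 : u₀ ≤ u := by nlinarith [le_abs_self u₀]
    refine (hL u (by linarith) x (abs_lt.1 (hx.trans_lt hu1)) y
      (abs_lt.1 (hy.trans_lt hu1))).trans ?_
    refine mul_le_mul_of_nonneg_right ((hu₀ u hu2).trans ?_) (abs_nonneg _)
    have hu3 : 0 ≤ u ^ m₁ := Real.rpow_nonneg (by linarith) _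
    calc K₀ * u ^ m₁ ≤ |K₀| * u ^ m₁ := by gcongr; exact le_abs_self _
      _ ≤ |K₀| * u ^ m := by gcongr; exact rpow_le_pow_natCeil (by linarith) m₁
      _ = _ := by rw [hu, mul_pow, hK₁]; ring
  set K₂ := |deriv (deriv ρ) 0| + K₁ with hK₂
  have hK₂0 : 0 ≤ K₂ := by positivity
  have h2 : ∀ M : ℝ, 1 ≤ M → ∀ x : ℝ, |x| ≤ M → |deriv (deriv ρ) x| ≤ K₂ * M ^ (m + 1) := by
    intro M hM x hx
    have h := h1 M hM x 0 hx (by simp; linarith)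
    rw [sub_zero] at h
    have h3 := abs_sub_abs_le_abs_sub (deriv (deriv ρ) x) (deriv (deriv ρ) 0)
    have h4 : K₁ * M ^ m * |x| ≤ K₁ * M ^ (m + 1) := by
      rw [pow_succ, ← mul_assoc]; gcongr
    have h5 : |deriv (deriv ρ) 0| ≤ |deriv (deriv ρ) 0| * M ^ (m + 1) :=
      le_mul_of_one_le_right (abs_nonneg _) (one_le_pow₀ hM)
    rw [hK₂, add_mul]; linarith
  have h3 : ∀ M : ℝ, 1 ≤ M → ∀ x : ℝ, |x| ≤ M → |deriv ρ x| ≤ K₂ * M ^ (m + 2) := by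
    intro M hM x hx
    have h := abs_sub_le_of_deriv_le_Icc hρ.differentiable_deriv (h2 M hM)
      (show |(0 : ℝ)| ≤ M by simp; linarith) hx
    rw [hρ.deriv_zero, sub_zero, sub_zero] at h
    refine h.trans ?_
    rw [pow_succ _ (m + 1), ← mul_assoc]; gcongr
  have h4 : ∀ M : ℝ, 1 ≤ M → ∀ x : ℝ, |x| ≤ M → ρ x ≤ K₂ * M ^ (m + 3) := by
    intro M hM x hx
    have h := abs_sub_le_of_deriv_le_Icc hρ.differentiable (h3 M hM)
      (show |(0 : ℝ)| ≤ M by simp; linarith) hx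
    rw [hρ.map_zero, sub_zero, sub_zero] at h
    refine (le_abs_self _).trans (h.trans ?_)
    rw [pow_succ _ (m + 2), ← mul_assoc]; gcongr
  have hmono : ∀ M : ℝ, 1 ≤ M → ∀ j, j ≤ m + 3 → K₂ * M ^ j ≤ K₂ * M ^ (m + 3) :=
    fun M hM j hj => by gcongr
  refine ⟨K₂, m + 3, hK₂0, fun M hM x y hx hy => ?_, fun M hM x hx => ?_, fun M hM x hx => ?_, h4⟩
  · refine (h1 M hM x y hx hy).trans (mul_le_mul_of_nonneg_right ?_ (abs_nonneg _))
    refine le_trans ?_ (hmono M hM m (by omega))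
    gcongr
    exact le_add_of_nonneg_left (abs_nonneg _)
  · exact (h2 M hM x hx).trans (hmono M hM _ (by omega))
  · exact (h3 M hM x hx).trans (hmono M hM _ (by omega))

theorem continuous_deriv2 : Continuous (deriv (deriv ρ)) := by
  obtain ⟨K, m, hb⟩ := hρ.exists_lossBounds
  refine continuous_iff_continuousAt.2 fun x => ?_
  set M := |x| + 1
  have hM : 1 ≤ M := le_add_of_nonneg_left (abs_nonneg x)
  refine tendsto_iff_dist_tendsto_zero.2 ?_
  have hlim : Tendsto (fun y => K * M ^ m * |y - x|) (𝓝 x) (𝓝 0) := by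
    have : Continuous fun y => K * M ^ m * |y - x| := by fun_prop
    simpa using this.tendsto x
  refine squeeze_zero' (Eventually.of_forall fun _ => dist_nonneg) ?_ hlim
  filter_upwards [Metric.ball_mem_nhds x one_pos] with y hy
  rw [Metric.mem_ball, Real.dist_eq] at hy
  refine hb.lipschitz M hM y x ?_ (by simp [M])
  have := abs_sub_abs_le_abs_sub y x
  simp only [M]; linarith

end LossAssumptions

theorem LossBounds.taylor_le {ρ : ℝ → ℝ} {K : ℝ} {m : ℕ} (hb : LossBounds ρ K m)
    (hd : Differentiable ℝ (deriv ρ)) {M r h : ℝ} (hM : 1 ≤ M) (h1 : |r| + |h| ≤ M) :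
    |deriv ρ (r - h) - deriv ρ r + h * deriv (deriv ρ) r| ≤ K * M ^ m * h ^ 2 := by
  have hK := hb.nonneg
  set g : ℝ → ℝ := fun t => deriv ρ (r - t) + t * deriv (deriv ρ) r
  have hg : ∀ t, HasDerivAt g (deriv (deriv ρ) r - deriv (deriv ρ) (r - t)) t := fun t => by
    have h2 : HasDerivAt (fun t : ℝ => r - t) (-1) t := (hasDerivAt_id t).const_sub r
    have h3 := (hd (r - t)).hasDerivAt.comp t h2
    convert! h3.add ((hasDerivAt_id t).mul_const (deriv (deriv ρ) r)) using 1
    simp; ring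
  have h4 := abs_sub_le_of_deriv_le_Icc (fun t => (hg t).differentiableAt) (M := |h|)
    (B := K * M ^ m * |h|) (fun t ht => by
      rw [(hg t).deriv]
      refine (hb.lipschitz M hM r (r - t) (by linarith [abs_nonneg h]) ?_).trans ?_
      · exact (abs_sub _ _).trans (by linarith)
      · rw [sub_sub_cancel]; gcongr) (x := 0) (by simp) le_rfl
  have h5 : g h - g 0 = deriv ρ (r - h) - deriv ρ r + h * deriv (deriv ρ) r := by
    simp [g]; ring
  rw [h5, sub_zero] at h4
  refine h4.trans (le_of_eq ?_)
  rw [mul_assoc, ← sq, sq_abs]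

/-! ### The estimating equation -/

/-- The gradient of the objective. -/
def score (ρ : ℝ → ℝ) (τ : ℝ) {n d : ℕ} (e : Fin n → ℝ) (X : Fin n → EuclideanSpace ℝ (Fin d))
    (β : EuclideanSpace ℝ (Fin d)) : EuclideanSpace ℝ (Fin d) :=
  τ • β - (1 / (n : ℝ)) • ∑ i, deriv ρ (e i - inner ℝ (X i) β) • X i

section Score

variable {ρ : ℝ → ℝ} {τ : ℝ} {n d : ℕ}

theorem hasDerivAt_objective (hρ : Differentiable ℝ ρ) (e : Fin n → ℝ)
    (X : Fin n → EuclideanSpace ℝ (Fin d)) (β v : EuclideanSpace ℝ (Fin d)) :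
    HasDerivAt (fun t : ℝ => objective ρ τ e X (β + t • v)) (inner ℝ (score ρ τ e X β) v) 0 := by
  have h1 : ∀ i, HasDerivAt (fun t : ℝ => ρ (e i - inner ℝ (X i) (β + t • v)))
      (deriv ρ (e i - inner ℝ (X i) β) * -inner ℝ (X i) v) 0 := fun i => by
    have h2 : HasDerivAt (fun t : ℝ => e i - inner ℝ (X i) (β + t • v)) (-inner ℝ (X i) v) 0 := by
      simp only [inner_add_right, inner_smul_right]
      simpa using (((hasDerivAt_id (0 : ℝ)).mul_const (inner ℝ (X i) v)).const_add
        (inner ℝ (X i) β)).const_sub (e i)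
    have h3 : HasDerivAt ρ (deriv ρ (e i - inner ℝ (X i) β))
        (e i - inner ℝ (X i) (β + (0 : ℝ) • v)) := by
      rw [zero_smul, add_zero]; exact (hρ _).hasDerivAt
    exact h3.comp 0 h2
  have h4 : HasDerivAt (fun t : ℝ => ‖β + t • v‖ ^ 2) (2 * inner ℝ β v) 0 := by
    have h5 : ∀ t : ℝ, ‖β + t • v‖ ^ 2 = ‖β‖ ^ 2 + t * (2 * inner ℝ β v) + t ^ 2 * ‖v‖ ^ 2 :=
      fun t => by
        rw [norm_add_sq_real, inner_smul_right, norm_smul, mul_pow, Real.norm_eq_abs, sq_abs]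
        ring
    simp only [h5]
    simpa using (((hasDerivAt_id (0 : ℝ)).mul_const (2 * inner ℝ β v)).const_add
      (‖β‖ ^ 2)).fun_add ((hasDerivAt_pow 2 (0 : ℝ)).mul_const (‖v‖ ^ 2))
  convert! ((HasDerivAt.fun_sum (u := Finset.univ) fun i _ => h1 i).const_mul (1 / (n : ℝ))).add
    (h4.const_mul (τ / 2)) using 1
  simp only [score, inner_sub_left, inner_smul_left, sum_inner, mul_neg,
    Finset.sum_neg_distrib, RCLike.conj_to_real]
  ring

theorem score_estimator (hρ : LossAssumptions ρ) (hτ : 0 < τ) (e : Fin n → ℝ)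
    (X : Fin n → EuclideanSpace ℝ (Fin d)) : score ρ τ e X (estimator ρ τ e X) = 0 := by
  refine ext_inner_right ℝ fun v => ?_
  rw [inner_zero_left]
  refine IsLocalMin.hasDerivAt_eq_zero (Eventually.of_forall fun t => ?_)
    (hasDerivAt_objective hρ.differentiable e X _ v)
  simpa using estimator_spec hρ.continuous hρ.nonneg hτ e X _

theorem inner_score_sub_score (hρ : LossAssumptions ρ) (e : Fin n → ℝ)
    (X : Fin n → EuclideanSpace ℝ (Fin d)) (β β' : EuclideanSpace ℝ (Fin d)) :
    τ * ‖β - β'‖ ^ 2 ≤ inner ℝ (score ρ τ e X β - score ρ τ e X β') (β - β') := by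
  have h1 : 0 ≤ ∑ i, (deriv ρ (e i - inner ℝ (X i) β') - deriv ρ (e i - inner ℝ (X i) β)) *
      inner ℝ (X i) (β - β') := by
    refine Finset.sum_nonneg fun i _ => ?_
    rw [inner_sub_right]
    rcases le_total (inner ℝ (X i) β : ℝ) (inner ℝ (X i) β') with h | h
    · exact mul_nonneg_of_nonpos_of_nonpos (sub_nonpos.2 (hρ.monotone_deriv (by linarith)))
        (by linarith)
    · exact mul_nonneg (sub_nonneg.2 (hρ.monotone_deriv (by linarith))) (by linarith)
  have h2 : inner ℝ (score ρ τ e X β - score ρ τ e X β') (β - β') =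
      τ * ‖β - β'‖ ^ 2 + (1 / (n : ℝ)) *
        ∑ i, (deriv ρ (e i - inner ℝ (X i) β') - deriv ρ (e i - inner ℝ (X i) β)) *
          inner ℝ (X i) (β - β') := by
    have h3 : score ρ τ e X β - score ρ τ e X β' = τ • (β - β') + (1 / (n : ℝ)) •
        ∑ i, (deriv ρ (e i - inner ℝ (X i) β') - deriv ρ (e i - inner ℝ (X i) β)) • X i := by
      simp only [score, sub_smul, Finset.sum_sub_distrib, smul_sub]
      abel
    rw [h3, inner_add_left, inner_smul_left, inner_smul_left, sum_inner, real_inner_self_eq_norm_sq]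
    simp [inner_smul_left]
  rw [h2]
  exact le_add_of_nonneg_right (by positivity)

theorem norm_sub_estimator_le (hρ : LossAssumptions ρ) (hτ : 0 < τ) (e : Fin n → ℝ)
    (X : Fin n → EuclideanSpace ℝ (Fin d)) (β : EuclideanSpace ℝ (Fin d)) :
    ‖estimator ρ τ e X - β‖ ≤ 1 / τ * ‖score ρ τ e X β‖ := by
  have h := inner_score_sub_score (τ := τ) hρ e X β (estimator ρ τ e X)
  rw [score_estimator hρ hτ, sub_zero] at h
  have h1 := h.trans (real_inner_le_norm _ _)
  rw [norm_sub_rev, one_div, ← div_eq_inv_mul, le_div_iff₀ hτ]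
  rcases (norm_nonneg (β - estimator ρ τ e X)).eq_or_lt with h0 | h0
  · rw [← h0]; simp
  · refine le_of_mul_le_mul_right ?_ h0
    linarith

theorem norm_estimator_le (hρ : LossAssumptions ρ) (hτ : 0 < τ) (e : Fin n → ℝ)
    (X : Fin n → EuclideanSpace ℝ (Fin d)) {B : ℝ} (hB : 0 ≤ B) (h : ∀ i, ρ (e i) ≤ B) :
    ‖estimator ρ τ e X‖ ≤ 1 + 2 * B / τ := by
  have h1 := estimator_spec hρ.continuous hρ.nonneg hτ e X 0
  have h2 : objective ρ τ e X 0 ≤ B := by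
    simp only [objective, inner_zero_right, sub_zero, norm_zero]
    have : ∑ i, ρ (e i) ≤ n * B := by
      simpa using Finset.sum_le_sum fun i (_ : i ∈ Finset.univ) => h i
    rcases Nat.eq_zero_or_pos n with rfl | hn
    · simpa using hB
    · have hn' : (0 : ℝ) < n := Nat.cast_pos.2 hn
      rw [one_div, ← div_eq_inv_mul]
      have := (div_le_iff₀' hn').2 this
      simpa using this
  have h3 : τ / 2 * ‖estimator ρ τ e X‖ ^ 2 ≤ B := by
    have : 0 ≤ (1 / (n : ℝ)) * ∑ i, ρ (e i - inner ℝ (X i) (estimator ρ τ e X)) :=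
      mul_nonneg (by positivity) (Finset.sum_nonneg fun i _ => hρ.nonneg _)
    have h4 := h1.trans h2
    unfold objective at h4
    linarith
  have h5 : ‖estimator ρ τ e X‖ ^ 2 ≤ 2 * B / τ := by
    rw [le_div_iff₀ hτ]; linarith
  nlinarith [sq_nonneg (‖estimator ρ τ e X‖ - 1)]

theorem score_update (e : Fin n → ℝ) (X : Fin n → EuclideanSpace ℝ (Fin d)) (i : Fin n)
    (β : EuclideanSpace ℝ (Fin d)) :
    score ρ τ e (Function.update X i 0) β =
      score ρ τ e X β + (1 / (n : ℝ)) • deriv ρ (e i - inner ℝ (X i) β) • X i := by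
  have h1 : ∑ j, deriv ρ (e j - inner ℝ (X j) β) • X j =
      ∑ j, deriv ρ (e j - inner ℝ (Function.update X i 0 j) β) • Function.update X i 0 j +
        deriv ρ (e i - inner ℝ (X i) β) • X i := by
    rw [← Finset.add_sum_erase _ _ (Finset.mem_univ i),
      ← Finset.add_sum_erase Finset.univ (fun j => deriv ρ
        (e j - inner ℝ (Function.update X i 0 j) β) • Function.update X i 0 j) (Finset.mem_univ i)]
    simp only [Function.update_self, smul_zero, zero_add]
    rw [add_comm]
    congr 1
    refine Finset.sum_congr rfl fun j hj => ?_
    rw [Function.update_of_ne (Finset.ne_of_mem_erase hj)]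
  unfold score
  rw [h1, smul_add]
  abel

/-- A residual is dominated by the corresponding leave-one-observation-out prediction error. -/
theorem abs_residual_le (hρ : LossAssumptions ρ) (hτ : 0 < τ) (e : Fin n → ℝ)
    (X : Fin n → EuclideanSpace ℝ (Fin d)) (i : Fin n) :
    |residual ρ τ e X i| ≤
      |e i - inner ℝ (X i) (estimator ρ τ e (Function.update X i 0))| := by
  have hn : (0 : ℝ) < n := Nat.cast_pos.2 (Fin.pos i)
  set a := estimator ρ τ e X with ha
  set b := estimator ρ τ e (Function.update X i 0) with hb
  have h := inner_score_sub_score (τ := τ) hρ e (Function.update X i 0) a b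
  rw [hb, score_estimator hρ hτ, ← hb, sub_zero, score_update, ha, score_estimator hρ hτ, ← ha,
    zero_add, inner_smul_left, inner_smul_left, inner_sub_right] at h
  simp only [RCLike.conj_to_real] at h
  unfold residual
  rw [← ha]
  set r := e i - inner ℝ (X i) a with hr
  set s := e i - inner ℝ (X i) b with hs
  have hrs : inner ℝ (X i) a - inner ℝ (X i) b = s - r := by rw [hr, hs]; ring
  rw [hrs] at h
  by_cases h0 : deriv ρ r = 0
  · rw [h0, zero_mul, mul_zero] at h
    have h1 : ‖a - b‖ ^ 2 ≤ 0 := by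
      by_contra! h2
      have := mul_pos hτ h2
      linarith
    have h2 : a = b := by
      have := pow_eq_zero_iff two_ne_zero |>.1 (le_antisymm h1 (sq_nonneg _))
      exact sub_eq_zero.1 (norm_eq_zero.1 this)
    rw [hr, hs, h2]
  · have h1 : 0 ≤ deriv ρ r * (s - r) := by
      have h2 : 0 ≤ 1 / (n : ℝ) * (deriv ρ r * (s - r)) := le_trans (by positivity) h
      exact nonneg_of_mul_nonneg_right h2 (by positivity)
    rcases le_total 0 r with h2 | h2
    · have h3 : 0 < deriv ρ r :=
        lt_of_le_of_ne (hρ.deriv_zero ▸ hρ.monotone_deriv h2) (Ne.symm h0)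
      have h4 : 0 ≤ s - r := nonneg_of_mul_nonneg_right h1 h3
      rw [abs_of_nonneg h2, abs_of_nonneg (by linarith)]
      linarith
    · have h3 : deriv ρ r < 0 :=
        lt_of_le_of_ne (hρ.deriv_zero ▸ hρ.monotone_deriv h2) h0
      have h4 : s - r ≤ 0 := by
        by_contra! h5
        have := mul_neg_of_neg_of_pos h3 h5
        linarith
      rw [abs_of_nonpos h2, abs_of_nonpos (by linarith)]
      linarith

theorem continuous_estimator (hρ : LossAssumptions ρ) (hτ : 0 < τ) :
    Continuous fun z : (Fin n → ℝ) × (Fin n → EuclideanSpace ℝ (Fin d)) =>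
      estimator ρ τ z.1 z.2 := by
  refine continuous_iff_continuousAt.2 fun z₀ => ?_
  refine tendsto_iff_norm_sub_tendsto_zero.2 ?_
  have hc : Continuous fun z : (Fin n → ℝ) × (Fin n → EuclideanSpace ℝ (Fin d)) =>
      1 / τ * ‖score ρ τ z.1 z.2 (estimator ρ τ z₀.1 z₀.2)‖ := by
    have := hρ.continuous_deriv
    unfold score
    fun_prop
  have h := hc.tendsto z₀
  rw [score_estimator hρ hτ, norm_zero, mul_zero] at h
  exact squeeze_zero (fun _ => norm_nonneg _) (fun z => norm_sub_estimator_le hρ hτ _ _ _) h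

end Score

/-! ### Weighted Gram matrices -/

section Gram

open Matrix

variable {n q : ℕ}

/-- `(1/n) ∑ᵢ Dᵢ Vᵢ Vᵢᵀ`. -/
def weightedGram (D : Fin n → ℝ) (V : Fin n → Fin q → ℝ) : Matrix (Fin q) (Fin q) ℝ :=
  Matrix.of fun j l => (1 / (n : ℝ)) * ∑ i, D i * V i j * V i l

/-- `(1/n) ∑ᵢ Dᵢ xᵢ Vᵢ`. -/
def weightedCross (D : Fin n → ℝ) (V : Fin n → Fin q → ℝ) (x : Fin n → ℝ) : Fin q → ℝ :=
  fun j => (1 / (n : ℝ)) * ∑ i, D i * V i j * x i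

/-- The regularized weighted Gram matrix. -/
def ridgeGram (τ : ℝ) (D : Fin n → ℝ) (V : Fin n → Fin q → ℝ) : Matrix (Fin q) (Fin q) ℝ :=
  weightedGram D V + τ • (1 : Matrix (Fin q) (Fin q) ℝ)

/-- The coefficients of `x` in the linear form `Vᵢᵀ (S + τ)⁻¹ (1/n) ∑ⱼ Dⱼ xⱼ Vⱼ`. -/
def loadings (τ : ℝ) (D : Fin n → ℝ) (V : Fin n → Fin q → ℝ) (i j : Fin n) : ℝ :=
  (1 / (n : ℝ)) * (D j * (V j ⬝ᵥ ((ridgeGram τ D V)⁻¹ *ᵥ V i)))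

variable {τ : ℝ} {D : Fin n → ℝ} (V : Fin n → Fin q → ℝ)

theorem dotProduct_weightedCross (x : Fin n → ℝ) (y : Fin q → ℝ) :
    y ⬝ᵥ weightedCross D V x = (1 / (n : ℝ)) * ∑ i, D i * (V i ⬝ᵥ y) * x i := by
  simp only [dotProduct, weightedCross, Finset.mul_sum, Finset.sum_mul]
  rw [Finset.sum_comm]
  refine Finset.sum_congr rfl fun i _ => Finset.sum_congr rfl fun j _ => by ring

theorem weightedGram_mulVec (y : Fin q → ℝ) :
    weightedGram D V *ᵥ y = weightedCross D V fun i => V i ⬝ᵥ y := by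
  ext j
  simp only [mulVec, dotProduct, weightedGram, weightedCross, Matrix.of_apply, Finset.mul_sum,
    Finset.sum_mul]
  rw [Finset.sum_comm]
  refine Finset.sum_congr rfl fun i _ => Finset.sum_congr rfl fun j _ => by ring

theorem ridgeGram_mulVec (y : Fin q → ℝ) :
    ridgeGram τ D V *ᵥ y = (weightedCross D V fun i => V i ⬝ᵥ y) + τ • y := by
  rw [ridgeGram, add_mulVec, weightedGram_mulVec, smul_mulVec, one_mulVec]

theorem dotProduct_ridgeGram_mulVec (y z : Fin q → ℝ) :
    y ⬝ᵥ (ridgeGram τ D V *ᵥ z) =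
      (1 / (n : ℝ)) * ∑ i, D i * (V i ⬝ᵥ y) * (V i ⬝ᵥ z) + τ * (y ⬝ᵥ z) := by
  rw [ridgeGram_mulVec, dotProduct_add, dotProduct_weightedCross, dotProduct_smul, smul_eq_mul]

theorem dotProduct_ridgeGram_comm (y z : Fin q → ℝ) :
    y ⬝ᵥ (ridgeGram τ D V *ᵥ z) = (ridgeGram τ D V *ᵥ y) ⬝ᵥ z := by
  rw [dotProduct_comm (ridgeGram τ D V *ᵥ y), dotProduct_ridgeGram_mulVec,
    dotProduct_ridgeGram_mulVec, dotProduct_comm z y]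
  congr 2
  exact Finset.sum_congr rfl fun i _ => by ring

theorem sum_weighted_sq_nonneg (hD : ∀ i, 0 ≤ D i) (f : Fin n → ℝ) :
    0 ≤ (1 / (n : ℝ)) * ∑ i, D i * f i * f i :=
  mul_nonneg (by positivity) (Finset.sum_nonneg fun i _ => by
    rw [mul_assoc]; exact mul_nonneg (hD i) (mul_self_nonneg _))

theorem isUnit_det_ridgeGram (hτ : 0 < τ) (hD : ∀ i, 0 ≤ D i) : IsUnit (ridgeGram τ D V).det := by
  rw [← Matrix.isUnit_iff_isUnit_det, ← Matrix.mulVec_injective_iff_isUnit]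
  intro y z hyz
  have h0 : ridgeGram τ D V *ᵥ (y - z) = 0 := by
    rw [mulVec_sub]; exact sub_eq_zero.2 hyz
  have h1 := dotProduct_ridgeGram_mulVec (τ := τ) (D := D) V (y - z) (y - z)
  rw [h0, dotProduct_zero] at h1
  have h2 := sum_weighted_sq_nonneg hD fun i => V i ⬝ᵥ (y - z)
  have h3 : 0 ≤ (y - z) ⬝ᵥ (y - z) := Finset.sum_nonneg fun i _ => mul_self_nonneg _
  have h4 : (y - z) ⬝ᵥ (y - z) = 0 := by
    by_contra h
    have := mul_pos hτ (lt_of_le_of_ne h3 (Ne.symm h))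
    linarith
  exact sub_eq_zero.1 (dotProduct_self_eq_zero.1 h4)

theorem ridgeGram_mulVec_inv (hτ : 0 < τ) (hD : ∀ i, 0 ≤ D i) (y : Fin q → ℝ) :
    ridgeGram τ D V *ᵥ ((ridgeGram τ D V)⁻¹ *ᵥ y) = y := by
  rw [mulVec_mulVec, Matrix.mul_nonsing_inv _ (isUnit_det_ridgeGram V hτ hD), one_mulVec]

theorem dotProduct_ridge_solution (hτ : 0 < τ) (hD : ∀ i, 0 ≤ D i) (x : Fin n → ℝ) (i : Fin n) :
    V i ⬝ᵥ ((ridgeGram τ D V)⁻¹ *ᵥ weightedCross D V x) = ∑ j, loadings τ D V i j * x j := by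
  set w := (ridgeGram τ D V)⁻¹ *ᵥ weightedCross D V x with hw
  set z := (ridgeGram τ D V)⁻¹ *ᵥ V i with hz
  have h1 : V i = ridgeGram τ D V *ᵥ z := (ridgeGram_mulVec_inv V hτ hD _).symm
  rw [h1, ← dotProduct_ridgeGram_comm, hw, ridgeGram_mulVec_inv V hτ hD, dotProduct_weightedCross,
    Finset.mul_sum]
  refine Finset.sum_congr rfl fun j _ => ?_
  simp only [loadings, ← hz]
  ring

theorem sum_loadings_sq_le (hτ : 0 < τ) (hD : ∀ i, 0 ≤ D i) {B : ℝ} (hB : ∀ i, D i ≤ B)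
    (i : Fin n) : ∑ j, loadings τ D V i j ^ 2 ≤ B * (V i ⬝ᵥ V i) / (n * τ) := by
  have hn : (0 : ℝ) < n := Nat.cast_pos.2 (Fin.pos i)
  have hB0 : 0 ≤ B := (hD i).trans (hB i)
  set z := (ridgeGram τ D V)⁻¹ *ᵥ V i with hz
  have h1 := dotProduct_ridgeGram_mulVec (τ := τ) (D := D) V z z
  rw [hz, ridgeGram_mulVec_inv V hτ hD, ← hz] at h1
  have h2 := sum_weighted_sq_nonneg hD fun j => V j ⬝ᵥ z
  have hzz : 0 ≤ z ⬝ᵥ z := Finset.sum_nonneg fun _ _ => mul_self_nonneg _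
  have hzV : 0 ≤ z ⬝ᵥ V i := by
    rw [h1]; positivity
  have hle : z ⬝ᵥ V i ≤ V i ⬝ᵥ V i / τ := by
    have hcs : (z ⬝ᵥ V i) ^ 2 ≤ (z ⬝ᵥ z) * (V i ⬝ᵥ V i) := by
      simpa [dotProduct, sq] using Finset.sum_mul_sq_le_sq_mul_sq Finset.univ z (V i)
    have hVV : 0 ≤ V i ⬝ᵥ V i := Finset.sum_nonneg fun _ _ => mul_self_nonneg _
    have h3 : τ * (z ⬝ᵥ z) ≤ z ⬝ᵥ V i := by linarith
    rw [le_div_iff₀ hτ]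
    rcases hzV.eq_or_lt with h0 | h0
    · rw [← h0, zero_mul]; exact hVV
    · refine le_of_mul_le_mul_left ?_ h0
      calc z ⬝ᵥ V i * (z ⬝ᵥ V i * τ) = τ * (z ⬝ᵥ V i) ^ 2 := by ring
        _ ≤ τ * ((z ⬝ᵥ z) * (V i ⬝ᵥ V i)) := by gcongr
        _ = (τ * (z ⬝ᵥ z)) * (V i ⬝ᵥ V i) := by ring
        _ ≤ _ := by gcongr
  have h4 : ∑ j, loadings τ D V i j ^ 2 ≤
      B / n * ((1 / (n : ℝ)) * ∑ j, D j * (V j ⬝ᵥ z) * (V j ⬝ᵥ z)) := by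
    simp only [loadings, ← hz, Finset.mul_sum]
    refine Finset.sum_le_sum fun j _ => ?_
    have : D j * (D j * (V j ⬝ᵥ z) ^ 2) ≤ B * (D j * (V j ⬝ᵥ z) ^ 2) :=
      mul_le_mul_of_nonneg_right (hB j) (mul_nonneg (hD j) (sq_nonneg _))
    calc _ = (1 / (n : ℝ)) ^ 2 * (D j * (D j * (V j ⬝ᵥ z) ^ 2)) := by ring
      _ ≤ (1 / (n : ℝ)) ^ 2 * (B * (D j * (V j ⬝ᵥ z) ^ 2)) := by gcongr
      _ = _ := by ring
  calc _ ≤ B / n * (z ⬝ᵥ V i) := h4.trans (by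
        gcongr
        rw [h1]; exact le_add_of_nonneg_right (by positivity))
    _ ≤ B / n * (V i ⬝ᵥ V i / τ) := by gcongr
    _ = _ := by field_simp

theorem ridge_schur_eq (hτ : 0 < τ) (hD : ∀ i, 0 ≤ D i) (x : Fin n → ℝ) {w : Fin q → ℝ}
    (hw : w = (ridgeGram τ D V)⁻¹ *ᵥ weightedCross D V x) :
    (1 / (n : ℝ)) * ∑ i, x i ^ 2 * D i - weightedCross D V x ⬝ᵥ w =
      (1 / (n : ℝ)) * ∑ i, D i * (x i - V i ⬝ᵥ w) * (x i - V i ⬝ᵥ w) + τ * (w ⬝ᵥ w) := by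
  have h1 := dotProduct_ridgeGram_mulVec (τ := τ) (D := D) V w w
  have h2 := dotProduct_weightedCross (D := D) V x w
  rw [dotProduct_comm _ w]
  have h3 : w ⬝ᵥ (ridgeGram τ D V *ᵥ w) = w ⬝ᵥ weightedCross D V x := by
    rw [hw, ridgeGram_mulVec_inv V hτ hD]
  have h4 : (1 / (n : ℝ)) * ∑ i, D i * (x i - V i ⬝ᵥ w) * (x i - V i ⬝ᵥ w) =
      (1 / (n : ℝ)) * ∑ i, x i ^ 2 * D i - 2 * ((1 / (n : ℝ)) * ∑ i, D i * (V i ⬝ᵥ w) * x i) +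
        (1 / (n : ℝ)) * ∑ i, D i * (V i ⬝ᵥ w) * (V i ⬝ᵥ w) := by
    simp only [Finset.mul_sum, ← Finset.sum_sub_distrib, ← Finset.sum_add_distrib]
    exact Finset.sum_congr rfl fun i _ => by ring
  rw [h4]
  linarith

end Gram

/-! ### The approximation `b̃` -/

section BTilde

theorem inner_eq_sum {d : ℕ} (x y : EuclideanSpace ℝ (Fin d)) :
    inner ℝ x y = ∑ j, x j * y j := by
  simp [PiLp.inner_apply, mul_comm]

variable (ρ : ℝ → ℝ) (τ : ℝ) {n q : ℕ} (e : Fin n → ℝ)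
  (X : Fin n → EuclideanSpace ℝ (Fin (q + 1)))

/-- `ψ'` at the residuals of the fit without the last predictor. -/
def weights (i : Fin n) : ℝ := deriv (deriv ρ) (looResidual ρ τ e X i)

/-- `Xᵢ(p) - Vᵢᵀ (𝔖_p + τ Id)⁻¹ u_p`. -/
def projected (i : Fin n) : ℝ :=
  lastEntry X i - (fun j => firstEntries X i j) ⬝ᵥ wVec ρ τ e X

theorem wVec_eq : wVec ρ τ e X =
    (ridgeGram τ (weights ρ τ e X) fun i j => firstEntries X i j)⁻¹.mulVec
      (weightedCross (weights ρ τ e X) (fun i j => firstEntries X i j) (lastEntry X)) := rfl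

theorem lastEntry_eq_projected (i : Fin n) : lastEntry X i =
    projected ρ τ e X i + (fun j => firstEntries X i j) ⬝ᵥ wVec ρ τ e X := by
  simp [projected]

theorem bTilde_last : bTilde ρ τ e X (Fin.last q) = gothicB ρ τ e X := by
  simp [bTilde]

theorem bTilde_castSucc (j : Fin q) : bTilde ρ τ e X j.castSucc =
    gammaHat ρ τ e X j - gothicB ρ τ e X * wVec ρ τ e X j := by
  simp [bTilde, sub_eq_add_neg]

theorem sub_inner_bTilde (i : Fin n) : e i - inner ℝ (X i) (bTilde ρ τ e X) =
    looResidual ρ τ e X i - gothicB ρ τ e X * projected ρ τ e X i := by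
  rw [looResidual, inner_eq_sum, inner_eq_sum, Fin.sum_univ_castSucc, bTilde_last]
  simp only [bTilde_castSucc, projected, dotProduct, mul_sub, Finset.sum_sub_distrib,
    Finset.mul_sum]
  have h1 : ∀ j, firstEntries X i j = X i j.castSucc := fun _ => rfl
  have h2 : ∑ j, X i (Fin.castSucc j) * (gothicB ρ τ e X * wVec ρ τ e X j) =
      ∑ j, gothicB ρ τ e X * (X i (Fin.castSucc j) * wVec ρ τ e X j) :=
    Finset.sum_congr rfl fun j _ => by ring
  simp only [h1, h2, lastEntry]
  ring

variable {ρ τ} (hρ : LossAssumptions ρ) (hτ : 0 < τ)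
include hρ hτ

theorem xi_eq : xi ρ τ e X = (1 / (n : ℝ)) * ∑ i, weights ρ τ e X i * projected ρ τ e X i *
    projected ρ τ e X i + τ * (wVec ρ τ e X ⬝ᵥ wVec ρ τ e X) :=
  ridge_schur_eq (fun i j => firstEntries X i j) hτ (fun _ => hρ.deriv2_nonneg _) (lastEntry X)
    (wVec_eq ρ τ e X)

theorem xi_nonneg : 0 ≤ xi ρ τ e X := by
  rw [xi_eq e X hρ hτ]
  have h1 := sum_weighted_sq_nonneg (D := weights ρ τ e X) (fun _ => hρ.deriv2_nonneg _)
    (projected ρ τ e X)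
  have h2 : 0 ≤ wVec ρ τ e X ⬝ᵥ wVec ρ τ e X := Finset.sum_nonneg fun _ _ => mul_self_nonneg _
  positivity

theorem wVec_apply (j : Fin q) : τ * wVec ρ τ e X j =
    (1 / (n : ℝ)) * ∑ i, weights ρ τ e X i * firstEntries X i j * projected ρ τ e X i := by
  have h := congrFun (ridgeGram_mulVec_inv (fun i j => firstEntries X i j) hτ
    (D := weights ρ τ e X) (fun _ => hρ.deriv2_nonneg _)
    (weightedCross (weights ρ τ e X) (fun i j => firstEntries X i j) (lastEntry X))) j
  rw [← wVec_eq, ridgeGram_mulVec, Pi.add_apply, Pi.smul_apply, smul_eq_mul] at h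
  simp only [weightedCross] at h
  rw [eq_sub_of_add_eq' h, ← mul_sub, ← Finset.sum_sub_distrib]
  congr 1
  exact Finset.sum_congr rfl fun i _ => by rw [projected]; ring

theorem gammaHat_apply (j : Fin q) : τ * gammaHat ρ τ e X j =
    (1 / (n : ℝ)) * ∑ i, deriv ρ (looResidual ρ τ e X i) * firstEntries X i j := by
  have h := score_estimator hρ hτ e (firstEntries X)
  have h1 := congrArg (fun v : EuclideanSpace ℝ (Fin q) => v j) h
  simp only [score, PiLp.sub_apply, PiLp.smul_apply, smul_eq_mul, WithLp.ofLp_sum,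
    Finset.sum_apply, PiLp.zero_apply] at h1
  exact sub_eq_zero.1 h1

theorem gothicB_mul (hn : 0 < n) : gothicB ρ τ e X * (τ + xi ρ τ e X) =
    (1 / (n : ℝ)) * ∑ i, lastEntry X i * deriv ρ (looResidual ρ τ e X i) := by
  have h0 : 0 < τ + xi ρ τ e X := add_pos_of_pos_of_nonneg hτ (xi_nonneg e X hρ hτ)
  have hn' : (0 : ℝ) < n := Nat.cast_pos.2 hn
  have hs : 0 < Real.sqrt n := Real.sqrt_pos.2 hn'
  rw [gothicB, bigN, div_mul_eq_mul_div, mul_div_mul_right _ _ h0.ne', mul_comm, mul_div_assoc,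
    mul_comm]
  congr 1
  rw [div_div, Real.mul_self_sqrt hn'.le]

/-- The gradient at `b̃` only involves the remainders of the first order expansion of `ψ`. -/
theorem score_bTilde (hn : 0 < n) : score ρ τ e X (bTilde ρ τ e X) =
    -((1 / (n : ℝ)) • ∑ i, (deriv ρ (looResidual ρ τ e X i - gothicB ρ τ e X * projected ρ τ e X i)
      - deriv ρ (looResidual ρ τ e X i) + gothicB ρ τ e X * projected ρ τ e X i *
        deriv (deriv ρ) (looResidual ρ τ e X i)) • X i) := by
  set b := gothicB ρ τ e X with hb
  ext l
  simp only [score, sub_inner_bTilde, PiLp.sub_apply, PiLp.neg_apply, PiLp.smul_apply,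
    smul_eq_mul, WithLp.ofLp_sum, Finset.sum_apply, ← hb]
  rw [sub_eq_iff_eq_add, ← sub_eq_neg_add, ← mul_sub, ← Finset.sum_sub_distrib]
  have hgen : ∀ i (y : ℝ), deriv ρ (looResidual ρ τ e X i - b * projected ρ τ e X i) * y -
      (deriv ρ (looResidual ρ τ e X i - b * projected ρ τ e X i) -
        deriv ρ (looResidual ρ τ e X i) + b * projected ρ τ e X i *
          deriv (deriv ρ) (looResidual ρ τ e X i)) * y =
      deriv ρ (looResidual ρ τ e X i) * y -
        b * (weights ρ τ e X i * y * projected ρ τ e X i) := fun i y => by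
    rw [weights]; ring
  simp only [hgen]
  rw [Finset.sum_sub_distrib, ← Finset.mul_sum, mul_sub, mul_left_comm _ b]
  induction l using Fin.lastCases with
  | cast j =>
    have h1 := gammaHat_apply e X hρ hτ j
    have h2 := wVec_apply e X hρ hτ j
    have h3 : ∀ i, firstEntries X i j = X i j.castSucc := fun _ => rfl
    simp only [h3] at h1 h2
    rw [bTilde_castSucc, ← h1, ← h2]
    ring
  | last =>
    have h1 := gothicB_mul e X hρ hτ hn
    have h2 := xi_eq e X hρ hτ
    rw [bTilde_last, ← hb]
    rw [← hb] at h1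
    have h3 : τ * (wVec ρ τ e X ⬝ᵥ wVec ρ τ e X) = (1 / (n : ℝ)) * ∑ i,
        weights ρ τ e X i * ((fun j => firstEntries X i j) ⬝ᵥ wVec ρ τ e X) *
          projected ρ τ e X i := by
      rw [dotProduct, Finset.mul_sum]
      simp only [← mul_assoc, wVec_apply e X hρ hτ, Finset.mul_sum, Finset.sum_mul, dotProduct]
      rw [Finset.sum_comm]
      exact Finset.sum_congr rfl fun i _ => Finset.sum_congr rfl fun j _ => by ring
    have h4 : (1 / (n : ℝ)) * ∑ i, weights ρ τ e X i * X i (Fin.last q) * projected ρ τ e X i =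
        xi ρ τ e X := by
      rw [h2, h3, ← mul_add, ← Finset.sum_add_distrib]
      congr 1
      refine Finset.sum_congr rfl fun i _ => ?_
      rw [show X i (Fin.last q) = lastEntry X i from rfl, lastEntry_eq_projected ρ τ e X i]
      ring
    rw [h4]
    have h5 : ∑ i, deriv ρ (looResidual ρ τ e X i) * X i (Fin.last q) =
        ∑ i, lastEntry X i * deriv ρ (looResidual ρ τ e X i) :=
      Finset.sum_congr rfl fun i _ => mul_comm _ _
    rw [h5, ← h1]
    ring

end BTilde

/-! ### Discretization of the operator norm of the design -/

theorem exists_half_net (d : ℕ) : ∃ s : Finset (EuclideanSpace ℝ (Fin d)), s.card ≤ 5 ^ d ∧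
    (∀ v ∈ s, ‖v‖ ≤ 1) ∧ ∀ x, ‖x‖ ≤ 1 → ∃ v ∈ s, ‖x - v‖ ≤ 1 / 2 := by
  classical
  set P : ℕ → Prop := fun k => ∃ s : Finset (EuclideanSpace ℝ (Fin d)), s.card = k ∧
    (∀ v ∈ s, ‖v‖ ≤ 1) ∧ ∀ v ∈ s, ∀ w ∈ s, v ≠ w → 1 / 2 ≤ ‖v - w‖ with hP
  have hbd : ∀ k, P k → k ≤ 5 ^ d := by
    rintro k ⟨s, rfl, h1, h2⟩
    have hinj : Function.Injective fun v : EuclideanSpace ℝ (Fin d) => (2 : ℝ) • v :=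
      smul_right_injective _ two_ne_zero
    have := Besicovitch.card_le_of_separated (s.image fun v => (2 : ℝ) • v) (fun c hc => by
      obtain ⟨v, hv, rfl⟩ := Finset.mem_image.1 hc
      rw [norm_smul, Real.norm_two]
      linarith [h1 v hv]) (fun c hc c' hc' hne => by
      obtain ⟨v, hv, rfl⟩ := Finset.mem_image.1 hc
      obtain ⟨w, hw, rfl⟩ := Finset.mem_image.1 hc'
      rw [← smul_sub, norm_smul, Real.norm_two]
      linarith [h2 v hv w hw fun h => hne (by rw [h])])
    rwa [Finset.card_image_of_injective _ hinj, finrank_euclideanSpace, Fintype.card_fin] at this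
  have h0 : P 0 := ⟨∅, by simp⟩
  obtain ⟨s, hs, h1, h2⟩ := Nat.findGreatest_spec (P := P) (Nat.zero_le (5 ^ d)) h0
  refine ⟨s, hbd _ ⟨s, rfl, h1, h2⟩, h1, fun x hx => ?_⟩
  by_contra! hfar
  have hxs : x ∉ s := fun h => by
    have := hfar x h
    rw [sub_self, norm_zero] at this
    linarith
  have hP' : P (s.card + 1) := by
    refine ⟨insert x s, Finset.card_insert_of_notMem hxs, fun v hv => ?_, fun v hv w hw hvw => ?_⟩
    · rcases Finset.mem_insert.1 hv with rfl | hv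
      · exact hx
      · exact h1 v hv
    · rcases Finset.mem_insert.1 hv with rfl | hv' <;> rcases Finset.mem_insert.1 hw with rfl | hw'
      · exact absurd rfl hvw
      · exact (hfar w hw').le
      · rw [norm_sub_rev]; exact (hfar v hv').le
      · exact h2 v hv' w hw' hvw
  have := Nat.le_findGreatest (hbd _ hP') hP'
  omega

/-- A `1/2`-net of the unit ball. -/
def halfNet (d : ℕ) : Finset (EuclideanSpace ℝ (Fin d)) := (exists_half_net d).choose

theorem card_halfNet_le (d : ℕ) : (halfNet d).card ≤ 5 ^ d := (exists_half_net d).choose_spec.1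

theorem norm_le_of_mem_halfNet {d : ℕ} {v : EuclideanSpace ℝ (Fin d)} (hv : v ∈ halfNet d) :
    ‖v‖ ≤ 1 := (exists_half_net d).choose_spec.2.1 v hv

theorem exists_mem_halfNet {d : ℕ} {x : EuclideanSpace ℝ (Fin d)} (hx : ‖x‖ ≤ 1) :
    ∃ v ∈ halfNet d, ‖x - v‖ ≤ 1 / 2 := (exists_half_net d).choose_spec.2.2 x hx

/-- `((1/n) ∑ᵢ (Xᵢᵀ v)²)^{1/2}`. -/
def empiricalNorm {n d : ℕ} (X : Fin n → EuclideanSpace ℝ (Fin d)) (v : EuclideanSpace ℝ (Fin d)) :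
    ℝ := Real.sqrt ((1 / (n : ℝ)) * ∑ i, inner ℝ (X i) v ^ 2)

/-- The discretized operator norm of `n^{-1/2} X`. -/
def netNorm {n d : ℕ} (X : Fin n → EuclideanSpace ℝ (Fin d)) : ℝ :=
  ⨆ v : halfNet d, |empiricalNorm X v|

theorem sum_inner_sq_le {n d : ℕ} (X : Fin n → EuclideanSpace ℝ (Fin d))
    (v : EuclideanSpace ℝ (Fin d)) :
    ∑ i, inner ℝ (X i) v ^ 2 ≤ n * (2 * netNorm X) ^ 2 * ‖v‖ ^ 2 := by
  set T : EuclideanSpace ℝ (Fin d) →L[ℝ] EuclideanSpace ℝ (Fin n) :=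
    LinearMap.toContinuousLinearMap
      { toFun := fun v => WithLp.toLp 2 fun i => inner ℝ (X i) v
        map_add' := fun v w => by ext i; simp [inner_add_right]
        map_smul' := fun c v => by ext i; simp [inner_smul_right] } with hT
  have hTn : ∀ v, ‖T v‖ ^ 2 = ∑ i, inner ℝ (X i) v ^ 2 := fun v => by
    rw [EuclideanSpace.norm_sq_eq]
    simp [hT]
  have hnet : ∀ v ∈ halfNet d, ‖T v‖ ≤ Real.sqrt n * netNorm X := fun v hv => by
    have h1 : |empiricalNorm X v| ≤ netNorm X :=
      le_ciSup (f := fun v : halfNet d => |empiricalNorm X v|) (Set.finite_range _).bddAbove ⟨v, hv⟩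
    rw [empiricalNorm, abs_of_nonneg (Real.sqrt_nonneg _), ← hTn] at h1
    rcases Nat.eq_zero_or_pos n with rfl | hn
    · have : ‖T v‖ ^ 2 = 0 := by rw [hTn]; simp
      rw [pow_eq_zero_iff two_ne_zero] at this
      rw [this]; simp
    · have hn' : (0 : ℝ) < n := Nat.cast_pos.2 hn
      calc ‖T v‖ = Real.sqrt n * Real.sqrt (1 / n * ‖T v‖ ^ 2) := by
            rw [← Real.sqrt_mul hn'.le, ← mul_assoc, mul_one_div_cancel hn'.ne', one_mul,
              Real.sqrt_sq (norm_nonneg _)]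
        _ ≤ _ := by gcongr
  have hN : 0 ≤ netNorm X := Real.iSup_nonneg fun _ => abs_nonneg _
  have hop : ‖T‖ ≤ Real.sqrt n * netNorm X + ‖T‖ / 2 := by
    refine ContinuousLinearMap.opNorm_le_of_unit_norm (by positivity) fun z hz => ?_
    obtain ⟨v, hv, hzv⟩ := exists_mem_halfNet hz.le
    calc ‖T z‖ = ‖T v + T (z - v)‖ := by rw [← map_add]; simp
      _ ≤ ‖T v‖ + ‖T‖ * ‖z - v‖ := (norm_add_le _ _).trans (by gcongr; exact T.le_opNorm _)
      _ ≤ Real.sqrt n * netNorm X + ‖T‖ * (1 / 2) := by gcongr; exact hnet v hv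
      _ = _ := by ring
  rw [← hTn]
  have h2 : ‖T v‖ ≤ 2 * (Real.sqrt n * netNorm X) * ‖v‖ :=
    (T.le_opNorm v).trans (by gcongr; linarith)
  calc ‖T v‖ ^ 2 ≤ (2 * (Real.sqrt n * netNorm X) * ‖v‖) ^ 2 := by gcongr
    _ = Real.sqrt n ^ 2 * (2 * netNorm X) ^ 2 * ‖v‖ ^ 2 := by ring
    _ = _ := by rw [Real.sq_sqrt (Nat.cast_nonneg n)]

section OperatorNorm

variable {n d : ℕ} {X : Fin n → EuclideanSpace ℝ (Fin d)} {Q : ℝ}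

theorem norm_sq_le_of_sum_inner_sq_le
    (h : ∀ v, ∑ i, inner ℝ (X i) v ^ 2 ≤ n * Q ^ 2 * ‖v‖ ^ 2) (i : Fin n) :
    ‖X i‖ ^ 2 ≤ n * Q ^ 2 := by
  have h1 := (Finset.single_le_sum (f := fun j => inner ℝ (X j) (X i) ^ 2)
    (fun _ _ => sq_nonneg _) (Finset.mem_univ i)).trans (h (X i))
  simp only [real_inner_self_eq_norm_sq] at h1
  rcases (sq_nonneg ‖X i‖).eq_or_lt with h0 | h0
  · rw [← h0]; positivity
  · refine le_of_mul_le_mul_right ?_ h0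
    linarith [sq (‖X i‖ ^ 2)]

theorem norm_sum_smul_le (hQ : 0 ≤ Q)
    (h : ∀ v, ∑ i, inner ℝ (X i) v ^ 2 ≤ n * Q ^ 2 * ‖v‖ ^ 2) {η : ℝ} (hη : 0 ≤ η) {c : Fin n → ℝ}
    (hc : ∀ i, |c i| ≤ η) : ‖∑ i, c i • X i‖ ≤ n * (Q * η) := by
  set s := ∑ i, c i • X i with hs
  have h1 : ‖s‖ ^ 2 = ∑ i, c i * inner ℝ (X i) s := by
    rw [← real_inner_self_eq_norm_sq]
    conv_lhs => rw [hs, sum_inner]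
    simp [inner_smul_left, ← hs]
  have h2 : (‖s‖ ^ 2) ^ 2 ≤ (n * η ^ 2) * (n * Q ^ 2 * ‖s‖ ^ 2) := by
    rw [h1]
    refine (Finset.sum_mul_sq_le_sq_mul_sq _ _ _).trans ?_
    rw [← h1]
    refine mul_le_mul ?_ (h s) (Finset.sum_nonneg fun _ _ => sq_nonneg _) (by positivity)
    have : ∀ i ∈ Finset.univ, c i ^ 2 ≤ η ^ 2 := fun i _ => sq_le_sq' (abs_le.1 (hc i)).1
      (abs_le.1 (hc i)).2
    simpa using Finset.sum_le_sum this
  rcases (norm_nonneg s).eq_or_lt with h0 | h0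
  · rw [← h0]; positivity
  · have h3 : ‖s‖ ^ 2 ≤ (n * (Q * η)) ^ 2 := by
      refine le_of_mul_le_mul_right ?_ (pow_pos h0 2)
      calc _ = (‖s‖ ^ 2) ^ 2 := by ring
        _ ≤ _ := h2
        _ = _ := by ring
    exact (sq_le_sq₀ h0.le (by positivity)).1 h3

end OperatorNorm

/-! ### The deterministic bound -/

/-- A bound for the residuals of the fit without the last predictor. -/
def residualBound (K : ℝ) (m : ℕ) (τ E G : ℝ) : ℝ := 1 + E + G * (1 + 2 * (K * (1 + E) ^ m) / τ)

/-- A bound for `√n 𝔟_p`. -/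
def slopeBound (K : ℝ) (m : ℕ) (τ R G : ℝ) : ℝ := G * (K * R ^ m) / τ

/-- A bound for the last predictor after projection. -/
def projectedBound (K : ℝ) (m : ℕ) (τ R Q G G' : ℝ) : ℝ := G + G' * (1 + K * R ^ m * Q ^ 2 / τ)

/-- A bound for `n τ ‖β̂ - b̃‖`. -/
def errorBound (K : ℝ) (m : ℕ) (R Q B P : ℝ) : ℝ := Q * (K * (R + B * P) ^ m * (B * P) ^ 2)

section Deterministic

variable {ρ : ℝ → ℝ} {τ : ℝ} (hρ : LossAssumptions ρ) (hτ : 0 < τ) {K : ℝ} {m : ℕ}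
  (hb : LossBounds ρ K m) {n q : ℕ} (hn : 0 < n) {e : Fin n → ℝ}
  {X : Fin n → EuclideanSpace ℝ (Fin (q + 1))}
include hρ hτ hb

omit hρ in
theorem one_le_residualBound {E G : ℝ} (hE : 0 ≤ E) (hG : 0 ≤ G) :
    1 ≤ residualBound K m τ E G := by
  have := hb.nonneg
  have : 0 ≤ G * (1 + 2 * (K * (1 + E) ^ m) / τ) := by positivity
  unfold residualBound
  linarith

theorem abs_looResidual_le {E G : ℝ} (hE : 0 ≤ E) (hG : 0 ≤ G) (he : ∀ i, |e i| ≤ E)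
    (hg : ∀ i, |inner ℝ (firstEntries X i)
        (estimator ρ τ e (Function.update (firstEntries X) i 0))| ≤
      G * ‖estimator ρ τ e (Function.update (firstEntries X) i 0)‖) (i : Fin n) :
    |looResidual ρ τ e X i| ≤ residualBound K m τ E G := by
  have hK := hb.nonneg
  refine (abs_residual_le hρ hτ e (firstEntries X) i).trans ((abs_sub _ _).trans ?_)
  have h1 := norm_estimator_le hρ hτ e (Function.update (firstEntries X) i 0)
    (B := K * (1 + E) ^ m) (by positivity)
    fun j => hb.loss_le (1 + E) (by linarith) _ (by linarith [he j])
  have h2 := (hg i).trans (mul_le_mul_of_nonneg_left h1 hG)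
  have h3 := he i
  unfold residualBound
  linarith

include hn in
theorem abs_gothicB_le {R G : ℝ} (hR : 1 ≤ R) (hG : 0 ≤ G)
    (hr : ∀ i, |looResidual ρ τ e X i| ≤ R)
    (hg : |∑ i, deriv ρ (looResidual ρ τ e X i) * lastEntry X i| ≤
      G * Real.sqrt (∑ i, deriv ρ (looResidual ρ τ e X i) ^ 2)) :
    |gothicB ρ τ e X| ≤ slopeBound K m τ R G * (1 / Real.sqrt n) := by
  have hK := hb.nonneg
  have hn' : (0 : ℝ) < n := Nat.cast_pos.2 hn
  have hs : 0 < Real.sqrt n := Real.sqrt_pos.2 hn'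
  have hx := xi_nonneg e X hρ hτ
  have h1 : Real.sqrt (∑ i, deriv ρ (looResidual ρ τ e X i) ^ 2) ≤ Real.sqrt n * (K * R ^ m) := by
    refine Real.sqrt_le_iff.2 ⟨by positivity, ?_⟩
    rw [mul_pow, Real.sq_sqrt hn'.le]
    have : ∀ i ∈ Finset.univ, deriv ρ (looResidual ρ τ e X i) ^ 2 ≤ (K * R ^ m) ^ 2 := fun i _ =>
      sq_le_sq' (abs_le.1 (hb.deriv_le R hR _ (hr i))).1 (abs_le.1 (hb.deriv_le R hR _ (hr i))).2
    simpa using Finset.sum_le_sum this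
  have h2 : |bigN ρ τ e X| ≤ G * (K * R ^ m) := by
    have h3 : ∑ i, lastEntry X i * deriv ρ (looResidual ρ τ e X i) =
        ∑ i, deriv ρ (looResidual ρ τ e X i) * lastEntry X i :=
      Finset.sum_congr rfl fun i _ => mul_comm _ _
    rw [bigN, h3, abs_mul, abs_of_pos (by positivity : 0 < 1 / Real.sqrt n)]
    calc _ ≤ 1 / Real.sqrt n * (G * (Real.sqrt n * (K * R ^ m))) := by
          gcongr
          exact hg.trans (by gcongr)
      _ = _ := by field_simp
  rw [gothicB, abs_div, abs_of_pos (by positivity : 0 < Real.sqrt n * (τ + xi ρ τ e X)), slopeBound]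
  calc _ ≤ G * (K * R ^ m) / (Real.sqrt n * τ) := by
        gcongr
        linarith
    _ = _ := by field_simp

include hn in
theorem abs_projected_le {R Q G G' : ℝ} (hR : 1 ≤ R) (hG' : 0 ≤ G')
    (hr : ∀ i, |looResidual ρ τ e X i| ≤ R)
    (hQ : ∀ v, ∑ i, inner ℝ (X i) v ^ 2 ≤ n * Q ^ 2 * ‖v‖ ^ 2)
    (hg : ∀ i, |lastEntry X i| ≤ G)
    (hg' : ∀ i, |∑ j, loadings τ (weights ρ τ e X) (fun i j => firstEntries X i j) i j *
      lastEntry X j| ≤ G' * Real.sqrt (∑ j, loadings τ (weights ρ τ e X)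
        (fun i j => firstEntries X i j) i j ^ 2)) (i : Fin n) :
    |projected ρ τ e X i| ≤ projectedBound K m τ R Q G G' := by
  have hK := hb.nonneg
  have hn' : (0 : ℝ) < n := Nat.cast_pos.2 hn
  have hV : (fun j => firstEntries X i j) ⬝ᵥ (fun j => firstEntries X i j) ≤ n * Q ^ 2 := by
    refine le_trans ?_ (norm_sq_le_of_sum_inner_sq_le hQ i)
    rw [EuclideanSpace.norm_sq_eq, Fin.sum_univ_castSucc]
    simp only [dotProduct, Real.norm_eq_abs, sq_abs]
    refine le_trans (le_of_eq (Finset.sum_congr rfl fun j _ => ?_))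
      (le_add_of_nonneg_right (sq_nonneg _))
    rw [sq]; rfl
  have h1 := sum_loadings_sq_le (fun i j => firstEntries X i j) hτ (D := weights ρ τ e X)
    (fun _ => hρ.deriv2_nonneg _) (B := K * R ^ m)
    (fun j => (le_abs_self _).trans (hb.deriv2_le R hR _ (hr j))) i
  have h2 : Real.sqrt (∑ j, loadings τ (weights ρ τ e X) (fun i j => firstEntries X i j) i j ^ 2) ≤
      1 + K * R ^ m * Q ^ 2 / τ := by
    have h3 : 0 ≤ K * R ^ m * Q ^ 2 / τ := by positivity
    refine Real.sqrt_le_iff.2 ⟨by positivity, h1.trans ?_⟩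
    calc _ ≤ K * R ^ m * (n * Q ^ 2) / (n * τ) := by gcongr
      _ = K * R ^ m * Q ^ 2 / τ := by field_simp
      _ ≤ _ := by nlinarith
  have h3 : (fun j => firstEntries X i j) ⬝ᵥ wVec ρ τ e X =
      ∑ j, loadings τ (weights ρ τ e X) (fun i j => firstEntries X i j) i j * lastEntry X j :=
    dotProduct_ridge_solution (fun i j => firstEntries X i j) hτ (fun _ => hρ.deriv2_nonneg _)
      (lastEntry X) i
  refine (abs_sub _ _).trans ?_
  rw [h3, projectedBound]
  exact add_le_add (hg i) ((hg' i).trans (by gcongr))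

include hn in
theorem norm_estimator_sub_bTilde_le {R Q B P : ℝ} (hR : 1 ≤ R) (hQ0 : 0 ≤ Q) (hB0 : 0 ≤ B)
    (hP0 : 0 ≤ P) (hr : ∀ i, |looResidual ρ τ e X i| ≤ R)
    (hQ : ∀ v, ∑ i, inner ℝ (X i) v ^ 2 ≤ n * Q ^ 2 * ‖v‖ ^ 2)
    (hB : |gothicB ρ τ e X| ≤ B * (1 / Real.sqrt n)) (hP : ∀ i, |projected ρ τ e X i| ≤ P) :
    ‖estimator ρ τ e X - bTilde ρ τ e X‖ ≤ errorBound K m R Q B P * (1 / τ * (1 / (n : ℝ))) := by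
  have hK := hb.nonneg
  have hn' : (0 : ℝ) < n := Nat.cast_pos.2 hn
  have hs : 1 ≤ Real.sqrt n := Real.one_le_sqrt.2 (by exact_mod_cast hn)
  refine (norm_sub_estimator_le hρ hτ e X _).trans ?_
  rw [score_bTilde e X hρ hτ hn, norm_neg, norm_smul, Real.norm_of_nonneg (by positivity)]
  have hbd : ∀ i, |gothicB ρ τ e X * projected ρ τ e X i| ≤ B * P * (1 / Real.sqrt n) := fun i => by
    rw [abs_mul]
    calc _ ≤ B * (1 / Real.sqrt n) * P := mul_le_mul hB (hP i) (abs_nonneg _) (by positivity)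
      _ = _ := by ring
  have hbd1 : ∀ i, |gothicB ρ τ e X * projected ρ τ e X i| ≤ B * P := fun i =>
    (hbd i).trans (mul_le_of_le_one_right (by positivity)
      ((div_le_one (by linarith)).2 hs))
  have h1 := norm_sum_smul_le hQ0 hQ
    (η := K * (R + B * P) ^ m * ((B * P) ^ 2 * (1 / (n : ℝ)))) (by positivity) (fun i => by
      refine (hb.taylor_le hρ.differentiable_deriv (M := R + B * P)
        (h := gothicB ρ τ e X * projected ρ τ e X i) (r := looResidual ρ τ e X i)
        (by nlinarith [mul_nonneg hB0 hP0]) (add_le_add (hr i) (hbd1 i))).trans ?_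
      gcongr
      rw [← sq_abs]
      calc _ ≤ (B * P * (1 / Real.sqrt n)) ^ 2 := by gcongr; exact hbd i
        _ = _ := by rw [mul_pow, div_pow, Real.sq_sqrt hn'.le, one_pow])
  calc _ ≤ 1 / τ * (1 / (n : ℝ) * (n * (Q * (K * (R + B * P) ^ m *
        ((B * P) ^ 2 * (1 / (n : ℝ))))))) := by gcongr
    _ = _ := by rw [errorBound]; field_simp

end Deterministic

/-! ### Continuity in the data -/

section Continuity

theorem continuous_ridgeGram_inv {T : Type*} [TopologicalSpace T] {n q : ℕ} {τ : ℝ} (hτ : 0 < τ)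
    {D : T → Fin n → ℝ} {V : T → Fin n → Fin q → ℝ} (hD : Continuous D) (hV : Continuous V)
    (hD0 : ∀ t i, 0 ≤ D t i) : Continuous fun t => (ridgeGram τ (D t) (V t))⁻¹ := by
  have hA : Continuous fun t => ridgeGram τ (D t) (V t) := by
    refine continuous_matrix fun j l => ?_
    simp only [ridgeGram, weightedGram, Matrix.add_apply, Matrix.of_apply]
    fun_prop
  simp only [Matrix.inv_def, Ring.inverse_eq_inv']
  exact (hA.matrix_det.inv₀ fun t => (isUnit_det_ridgeGram (V t) hτ (hD0 t)).ne_zero).smul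
    hA.matrix_adjugate

variable {ρ : ℝ → ℝ} {τ : ℝ} (hρ : LossAssumptions ρ) (hτ : 0 < τ) {n d q : ℕ}
include hρ hτ

theorem continuous_residual : Continuous
    fun z : (Fin n → ℝ) × (Fin n → EuclideanSpace ℝ (Fin d)) => residual ρ τ z.1 z.2 := by
  have := continuous_estimator (n := n) (d := d) hρ hτ
  unfold residual
  fun_prop

theorem continuous_loadings : Continuous
    fun z : (Fin n → ℝ) × (Fin n → EuclideanSpace ℝ (Fin d)) =>
      loadings τ (fun i => deriv (deriv ρ) (residual ρ τ z.1 z.2 i)) fun i j => z.2 i j := by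
  have h1 := continuous_residual (n := n) (d := d) hρ hτ
  have h2 := hρ.continuous_deriv2
  have h3 := continuous_ridgeGram_inv (T := (Fin n → ℝ) × (Fin n → EuclideanSpace ℝ (Fin d))) hτ
    (D := fun z i => deriv (deriv ρ) (residual ρ τ z.1 z.2 i)) (V := fun z i j => z.2 i j)
    (by fun_prop) (by fun_prop) (fun _ _ => hρ.deriv2_nonneg _)
  refine continuous_pi fun i => continuous_pi fun j => ?_
  unfold loadings dotProduct Matrix.mulVec dotProduct
  fun_prop

omit hρ hτ in
theorem continuous_firstEntries : Continuous
    fun X : Fin n → EuclideanSpace ℝ (Fin (q + 1)) => firstEntries X := by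
  unfold firstEntries
  fun_prop

theorem continuous_gammaHat : Continuous
    fun z : (Fin n → ℝ) × (Fin n → EuclideanSpace ℝ (Fin (q + 1))) => gammaHat ρ τ z.1 z.2 :=
  (continuous_estimator hρ hτ).comp
    (continuous_fst.prodMk (continuous_firstEntries.comp continuous_snd))

theorem continuous_looResidual : Continuous
    fun z : (Fin n → ℝ) × (Fin n → EuclideanSpace ℝ (Fin (q + 1))) => looResidual ρ τ z.1 z.2 :=
  (continuous_residual hρ hτ).comp
    (continuous_fst.prodMk (continuous_firstEntries.comp continuous_snd))

theorem continuous_wVec : Continuous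
    fun z : (Fin n → ℝ) × (Fin n → EuclideanSpace ℝ (Fin (q + 1))) => wVec ρ τ z.1 z.2 := by
  have h1 := continuous_looResidual (n := n) (q := q) hρ hτ
  have h2 := hρ.continuous_deriv2
  have h4 := continuous_firstEntries (n := n) (q := q)
  have h3 := continuous_ridgeGram_inv
    (T := (Fin n → ℝ) × (Fin n → EuclideanSpace ℝ (Fin (q + 1)))) hτ
    (D := fun z => weights ρ τ z.1 z.2) (V := fun z i j => firstEntries z.2 i j)
    (by unfold weights; fun_prop) (by fun_prop) (fun _ _ => hρ.deriv2_nonneg _)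
  refine continuous_pi fun j => ?_
  simp only [wVec_eq]
  unfold Matrix.mulVec dotProduct weightedCross weights lastEntry
  unfold weights at h3
  fun_prop

theorem continuous_gothicB : Continuous
    fun z : (Fin n → ℝ) × (Fin n → EuclideanSpace ℝ (Fin (q + 1))) => gothicB ρ τ z.1 z.2 := by
  have h1 := continuous_looResidual (n := n) (q := q) hρ hτ
  have h2 := hρ.continuous_deriv
  have h3 := hρ.continuous_deriv2
  have h4 := continuous_wVec (n := n) (q := q) hρ hτ
  have h5 := continuous_firstEntries (n := n) (q := q)
  have hx : Continuous fun z : (Fin n → ℝ) × (Fin n → EuclideanSpace ℝ (Fin (q + 1))) =>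
      xi ρ τ z.1 z.2 := by
    unfold xi uVec lastEntry dotProduct
    fun_prop
  have hN : Continuous fun z : (Fin n → ℝ) × (Fin n → EuclideanSpace ℝ (Fin (q + 1))) =>
      bigN ρ τ z.1 z.2 := by
    unfold bigN lastEntry
    fun_prop
  simp only [gothicB, ← div_div]
  exact (hN.div_const _).div (continuous_const.add hx) fun z =>
    (add_pos_of_pos_of_nonneg hτ (xi_nonneg z.1 z.2 hρ hτ)).ne'

theorem continuous_bTilde : Continuous
    fun z : (Fin n → ℝ) × (Fin n → EuclideanSpace ℝ (Fin (q + 1))) => bTilde ρ τ z.1 z.2 := by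
  have h1 := continuous_gothicB (n := n) (q := q) hρ hτ
  have h2 := continuous_wVec (n := n) (q := q) hρ hτ
  have h3 := continuous_gammaHat (n := n) (q := q) hρ hτ
  refine (PiLp.continuous_toLp 2 _).comp (continuous_pi fun l => ?_)
  induction l using Fin.lastCases with
  | cast j =>
    refine Continuous.congr ?_ fun z => (bTilde_castSucc ρ τ z.1 z.2 j).symm
    fun_prop
  | last => exact h1.congr fun z => (bTilde_last ρ τ z.1 z.2).symm

end Continuity

/-! ### Independence -/

section Independence

variable {Ω : Type*} [MeasurableSpace Ω] {μ : Measure Ω} [IsProbabilityMeasure μ]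

theorem indepFun_prodMk_of_indepFun {α β γ : Type*} [MeasurableSpace α] [MeasurableSpace β]
    [MeasurableSpace γ] {f : Ω → α} {g : Ω → β} {h : Ω → γ} (hf : Measurable f)
    (hg : Measurable g) (hh : Measurable h) (h1 : IndepFun f g μ)
    (h2 : IndepFun (fun ω => (f ω, g ω)) h μ) : IndepFun f (fun ω => (g ω, h ω)) μ := by
  have := Measure.isProbabilityMeasure_map (μ := μ) hf.aemeasurable
  have := Measure.isProbabilityMeasure_map (μ := μ) hg.aemeasurable
  have := Measure.isProbabilityMeasure_map (μ := μ) hh.aemeasurable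
  have h3 : IndepFun g h μ := h2.comp measurable_snd measurable_id
  rw [indepFun_iff_map_prod_eq_prod_map_map (by fun_prop) (by fun_prop)] at h1 h2 h3 ⊢
  rw [h3, ← Measure.prodAssoc_prod, ← h1, ← h2, Measure.map_map (by fun_prop) (by fun_prop)]
  rfl

theorem indepFun_update_zero {F E : Type*} [MeasurableSpace F] [MeasurableSpace E] [Zero F] {n : ℕ}
    {V : Fin n → Ω → F} {e : Ω → E} (hV : ∀ i, Measurable (V i)) (he : Measurable e)
    (hind : iIndepFun V μ) (hVe : IndepFun (fun ω i => V i ω) e μ) (i : Fin n) :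
    IndepFun (V i) (fun ω => (Function.update (fun j => V j ω) i 0, e ω)) μ := by
  have hu : Measurable fun v : Fin n → F => Function.update v i 0 := by
    refine measurable_pi_iff.2 fun j => ?_
    by_cases hj : j = i
    · subst hj; simp
    · simpa [hj] using measurable_pi_apply j
  refine indepFun_prodMk_of_indepFun (hV i) (hu.comp (measurable_pi_iff.2 hV)) he ?_ ?_
  · have h1 := hind.indepFun_finset {i} {i}ᶜ disjoint_compl_right hV
    have h2 : Measurable fun (f : ({i}ᶜ : Finset (Fin n)) → F) (j : Fin n) =>
        if h : j ∈ ({i}ᶜ : Finset (Fin n)) then f ⟨j, h⟩ else 0 := by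
      refine measurable_pi_iff.2 fun j => ?_
      split_ifs with h
      · exact measurable_pi_apply _
      · exact measurable_const
    convert h1.comp (measurable_pi_apply (⟨i, Finset.mem_singleton_self i⟩ :
      ({i} : Finset (Fin n)))) h2 using 1
    · rfl
    funext ω j
    by_cases hj : j = i
    · subst hj; simp
    · simp [hj]
  · exact hVe.comp (φ := fun v => (v i, Function.update v i 0))
      ((measurable_pi_apply i).prodMk hu) measurable_id

variable {n d q : ℕ} {C c : ℝ}

omit [IsProbabilityMeasure μ] in
theorem DesignAssumptions.measurable_entry {X : Fin n → Ω → EuclideanSpace ℝ (Fin d)}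
    (hX : DesignAssumptions μ X C c) (i : Fin n) (j : Fin d) : Measurable fun ω => X i ω j := by
  have := hX.measurable i
  fun_prop

omit [IsProbabilityMeasure μ] in
theorem DesignAssumptions.iIndepFun_entries {X : Fin n → Ω → EuclideanSpace ℝ (Fin d)}
    (hX : DesignAssumptions μ X C c) :
    iIndepFun (fun (p : Fin n × Fin d) ω => X p.1 ω p.2) μ :=
  iIndepFun_uncurry' (X := fun i j ω => X i ω j) (fun i j => hX.measurable_entry i j)
    (hX.indep.comp (fun _ (v : EuclideanSpace ℝ (Fin d)) j => v j) fun _ => by fun_prop)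
    hX.indep_entries

theorem DesignAssumptions.indepFun_lastEntry {X : Fin n → Ω → EuclideanSpace ℝ (Fin (q + 1))}
    (hX : DesignAssumptions μ X C c) {e : Ω → Fin n → ℝ} (he : Measurable e)
    (hXe : IndepFun (fun ω i => X i ω) e μ) :
    IndepFun (fun ω => lastEntry fun i => X i ω)
      (fun ω => (firstEntries (fun i => X i ω), e ω)) μ := by
  have hm := measurable_pi_iff.2 hX.measurable
  have hl : Measurable fun x : Fin n → EuclideanSpace ℝ (Fin (q + 1)) => lastEntry x := by
    unfold lastEntry; fun_prop
  have hf : Measurable fun x : Fin n → EuclideanSpace ℝ (Fin (q + 1)) => firstEntries x :=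
    continuous_firstEntries.measurable
  refine indepFun_prodMk_of_indepFun (hl.comp hm) (hf.comp hm) he ?_ ?_
  · set S : Finset (Fin n × Fin (q + 1)) := Finset.univ.filter fun p => p.2 = Fin.last q with hS
    have h1 := hX.iIndepFun_entries.indepFun_finset S Sᶜ disjoint_compl_right
      fun p => hX.measurable_entry p.1 p.2
    have hmem : ∀ i, (i, Fin.last q) ∈ S := fun i => by simp [hS]
    have hmem' : ∀ i (j : Fin q), (i, j.castSucc) ∈ Sᶜ := fun i j => by
      simp [hS, (Fin.castSucc_lt_last j).ne]
    have h2 : Measurable fun (f : S → ℝ) (i : Fin n) => f ⟨(i, Fin.last q), hmem i⟩ := by fun_prop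
    have h3 : Measurable fun (f : (Sᶜ : Finset (Fin n × Fin (q + 1))) → ℝ) (i : Fin n) =>
        (WithLp.toLp 2 fun j => f ⟨(i, j.castSucc), hmem' i j⟩ : EuclideanSpace ℝ (Fin q)) := by
      fun_prop
    exact h1.comp h2 h3
  · exact hXe.comp (φ := fun x => (lastEntry x, firstEntries x)) (hl.prodMk hf) measurable_id

theorem DesignAssumptions.hasSubgaussianMGF {X : Fin n → Ω → EuclideanSpace ℝ (Fin d)}
    (hX : DesignAssumptions μ X C c) (hc : 0 < c) (i : Fin n) (j : Fin d) :
    0 ≤ C ∧ HasSubgaussianMGF (fun ω => X i ω j)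
      (Real.toNNReal (2 * (1 + Real.log ((1 + C) ^ 2)) / (c / 4))) μ := by
  obtain ⟨m, hm⟩ := hX.concentration i (fun v => v j)
    ⟨convex_univ, fun x _ y _ a b _ _ _ => by simp⟩
    (LipschitzWith.of_dist_le_mul fun x y => by
      rw [NNReal.coe_one, one_mul, dist_eq_norm, dist_eq_norm]
      simpa using PiLp.norm_apply_le (x - y) j)
  have hC : 0 ≤ C := by
    have := measureReal_nonneg.trans (hm 1 one_pos)
    exact nonneg_of_mul_nonneg_left this (Real.exp_pos _)
  exact ⟨hC, hasSubgaussianMGF_of_concentration (hX.measurable_entry i j) (hX.memLp_two i j)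
    (hX.mean_zero i j) hc hC hm⟩

end Independence

/-! ### Normalized linear forms -/

section NormalizedForm

variable {ι : Type*} [Fintype ι]

/-- The linear form `y ↦ aᵀ y / ‖a‖`. -/
def normalizedForm (a y : ι → ℝ) : ℝ := (∑ j, a j * y j) / Real.sqrt (∑ j, a j ^ 2)

theorem abs_sum_mul_le_of_normalizedForm {a y : ι → ℝ} {B : ℝ} (h : |normalizedForm a y| ≤ B) :
    |∑ j, a j * y j| ≤ B * Real.sqrt (∑ j, a j ^ 2) := by
  rcases (Real.sqrt_nonneg (∑ j, a j ^ 2)).eq_or_lt with h0 | h0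
  · have h1 := Real.sqrt_eq_zero'.1 h0.symm
    have h2 : ∀ j, a j = 0 := fun j => by
      have := (Finset.sum_eq_zero_iff_of_nonneg fun j _ => sq_nonneg (a j)).1
        (le_antisymm h1 (Finset.sum_nonneg fun j _ => sq_nonneg (a j))) j (Finset.mem_univ j)
      exact pow_eq_zero_iff two_ne_zero |>.1 this
    simp [h2]
  · rwa [normalizedForm, abs_div, abs_of_pos h0, div_le_iff₀ h0] at h

theorem measurable_normalizedForm :
    Measurable fun z : (ι → ℝ) × (ι → ℝ) => normalizedForm z.1 z.2 := by
  unfold normalizedForm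
  fun_prop

variable {Ω : Type*} [MeasurableSpace Ω] {μ : Measure Ω} [IsProbabilityMeasure μ]

theorem expSqBound_normalizedForm {Y : Ω → ι → ℝ} (hY : Measurable Y)
    (hind : iIndepFun (fun j ω => Y ω j) μ) {σ : NNReal} (hσ : 0 < σ)
    (h : ∀ j, HasSubgaussianMGF (fun ω => Y ω j) σ μ) (a : ι → ℝ) :
    ExpSqBound μ (fun ω => normalizedForm a (Y ω)) (1 / (4 * σ)) 3 := by
  have h1 := expSqBound_sum_mul (fun j => measurable_pi_iff.1 hY j) hind hσ h
    (fun j => a j / Real.sqrt (∑ j, a j ^ 2)) (by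
      simp only [div_pow]
      rw [← Finset.sum_div, Real.sq_sqrt (Finset.sum_nonneg fun j _ => sq_nonneg _)]
      exact div_self_le_one _)
  convert h1 using 2
  rw [normalizedForm, Finset.sum_div]
  exact Finset.sum_congr rfl fun j _ => by ring

theorem expSqBound_normalizedForm_of_indepFun {G : Type*} [MeasurableSpace G] {W : Ω → G}
    {Y : Ω → ι → ℝ} (hW : Measurable W) (hY : Measurable Y) (hWY : IndepFun W Y μ)
    (hind : iIndepFun (fun j ω => Y ω j) μ) {σ : NNReal} (hσ : 0 < σ)
    (h : ∀ j, HasSubgaussianMGF (fun ω => Y ω j) σ μ) {a : G → ι → ℝ} (ha : Measurable a) :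
    ExpSqBound μ (fun ω => normalizedForm (a (W ω)) (Y ω)) (1 / (4 * σ)) 3 :=
  expSqBound_of_indepFun hW hY hWY (h := fun g y => normalizedForm (a g) y)
    (measurable_normalizedForm.comp ((ha.comp measurable_fst).prodMk measurable_snd))
    fun g => expSqBound_normalizedForm hY hind hσ h (a g)

/-- The discretized operator norm has bounded exponential square moments. -/
theorem expSqBound_netNorm {n d : ℕ} {C c : ℝ} {X : Fin n → Ω → EuclideanSpace ℝ (Fin d)}
    (hX : DesignAssumptions μ X C c) (hn : 0 < n) {σ : NNReal} (hσ : 0 < σ)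
    (h : ∀ i j, HasSubgaussianMGF (fun ω => X i ω j) σ μ) :
    ExpSqBound μ (fun ω => netNorm fun i => X i ω) (1 / (4 * σ))
      ((5 ^ (d + n + 1)) ^ (1 / (n : ℝ))) := by
  have hn' : (0 : ℝ) < n := Nat.cast_pos.2 hn
  have hmX := hX.measurable
  have hmeas : ∀ v, Measurable fun ω => empiricalNorm (fun i => X i ω) v := fun v => by
    unfold empiricalNorm
    fun_prop
  set s : ℝ := 1 / (4 * σ) with hs
  have hs0 : 0 < s := by
    have : (0 : ℝ) < σ := hσ
    positivity
  have h1 : ∀ v : halfNet d, ExpSqBound μ (fun ω => empiricalNorm (fun i => X i ω) v) (n * s)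
      (3 ^ n) := fun v => by
    have h2 : ∀ i, ExpSqBound μ (fun ω => inner ℝ (X i ω) (v : EuclideanSpace ℝ (Fin d))) s 3 :=
      fun i => by
        have h3 := expSqBound_sum_mul (fun j => hX.measurable_entry i j) (hX.indep_entries i) hσ
          (h i) (fun j => (v : EuclideanSpace ℝ (Fin d)) j) (by
            have h4 := norm_le_of_mem_halfNet v.2
            have h5 := EuclideanSpace.norm_sq_eq (v : EuclideanSpace ℝ (Fin d))
            simp only [Real.norm_eq_abs, sq_abs] at h5
            rw [← h5]
            exact pow_le_one₀ (norm_nonneg _) h4)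
        convert h3 using 2
        rw [inner_eq_sum]
        exact Finset.sum_congr rfl fun j _ => mul_comm _ _
    unfold ExpSqBound at h2 ⊢
    calc _ = ∫⁻ ω, ∏ i, ENNReal.ofReal
          (Real.exp (s * inner ℝ (X i ω) (v : EuclideanSpace ℝ (Fin d)) ^ 2)) ∂μ := by
          refine lintegral_congr fun ω => ?_
          simp only [empiricalNorm]
          rw [← ENNReal.ofReal_prod_of_nonneg fun _ _ => (Real.exp_pos _).le, ← Real.exp_sum,
            ← Finset.mul_sum, Real.sq_sqrt (mul_nonneg (by positivity)
              (Finset.sum_nonneg fun _ _ => sq_nonneg _))]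
          congr 2
          field_simp
      _ = ∏ i, ∫⁻ ω, ENNReal.ofReal
          (Real.exp (s * inner ℝ (X i ω) (v : EuclideanSpace ℝ (Fin d)) ^ 2)) ∂μ :=
          lintegral_prod_eq_prod_lintegral_of_indepFun Finset.univ
            (fun i ω => ENNReal.ofReal
              (Real.exp (s * inner ℝ (X i ω) (v : EuclideanSpace ℝ (Fin d)) ^ 2)))
            (hX.indep.comp (fun _ x => ENNReal.ofReal
              (Real.exp (s * inner ℝ x (v : EuclideanSpace ℝ (Fin d)) ^ 2))) fun _ => by fun_prop)
            fun i => by fun_prop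
      _ ≤ ∏ _i : Fin n, ENNReal.ofReal 3 := Finset.prod_le_prod' fun i _ => h2 i
      _ = _ := by
          rw [Finset.prod_const, Finset.card_univ, Fintype.card_fin,
            ENNReal.ofReal_pow (by norm_num)]
  have h2 := expSqBound_iSup_abs (fun v : halfNet d => hmeas v) (by positivity) h1
  have h3 : 1 + (Fintype.card (halfNet d) : ℝ) * 3 ^ n ≤ 5 ^ (d + n + 1) := by
    have h4 : (Fintype.card (halfNet d) : ℝ) ≤ 5 ^ d := by
      rw [Fintype.card_coe]
      exact_mod_cast card_halfNet_le d
    have h5 : (3 : ℝ) ^ n ≤ 5 ^ n := by gcongr; norm_num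
    have h6 : (1 : ℝ) ≤ 5 ^ d := one_le_pow₀ (by norm_num)
    have h7 : (1 : ℝ) ≤ 5 ^ n := one_le_pow₀ (by norm_num)
    have h8 : (Fintype.card (halfNet d) : ℝ) * 3 ^ n ≤ 5 ^ d * 5 ^ n := by gcongr
    rw [pow_succ, pow_add]
    nlinarith [one_le_mul_of_one_le_of_one_le h6 h7]
  have h4 := (h2.mono (fun _ => le_rfl) h3).rpow (θ := 1 / (n : ℝ)) (by positivity) (by positivity)
    (Measurable.iSup fun v : halfNet d => (hmeas v).abs).aemeasurable (by positivity)
    ((div_le_one hn').2 (by exact_mod_cast hn))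
  rwa [← mul_assoc, one_div_mul_cancel hn'.ne', one_mul] at h4

end NormalizedForm

/-! ### The random factors in the deterministic bound -/

section RandomFactors

/-- Normalized leave-one-observation-out predictions. -/
def predictionFactor (ρ : ℝ → ℝ) (τ : ℝ) {n q : ℕ} (e : Fin n → ℝ)
    (X : Fin n → EuclideanSpace ℝ (Fin (q + 1))) (i : Fin n) : ℝ :=
  normalizedForm (fun j => estimator ρ τ e (Function.update (firstEntries X) i 0) j)
    fun j => firstEntries X i j

/-- The normalized linear form in the last predictor with coefficients `ψ(r_{i,[p]})`. -/
def slopeFactor (ρ : ℝ → ℝ) (τ : ℝ) {n q : ℕ} (e : Fin n → ℝ)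
    (X : Fin n → EuclideanSpace ℝ (Fin (q + 1))) : ℝ :=
  normalizedForm (fun i => deriv ρ (looResidual ρ τ e X i)) (lastEntry X)

/-- The normalized regression predictions of the last predictor. -/
def loadingFactor (ρ : ℝ → ℝ) (τ : ℝ) {n q : ℕ} (e : Fin n → ℝ)
    (X : Fin n → EuclideanSpace ℝ (Fin (q + 1))) (i : Fin n) : ℝ :=
  normalizedForm (loadings τ (weights ρ τ e X) (fun i j => firstEntries X i j) i) (lastEntry X)

variable {Ω : Type*} [MeasurableSpace Ω] {μ : Measure Ω} [IsProbabilityMeasure μ]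
  {ρ : ℝ → ℝ} {τ : ℝ} (hρ : LossAssumptions ρ) (hτ : 0 < τ) {n q : ℕ} {C c : ℝ}
  {X : Fin n → Ω → EuclideanSpace ℝ (Fin (q + 1))} (hX : DesignAssumptions μ X C c)
  {ε : Fin n → Ω → ℝ} (hε : ∀ i, Measurable (ε i))
  (hXε : IndepFun (fun ω i => X i ω) (fun ω i => ε i ω) μ)
  {σ : NNReal} (hσ : 0 < σ) (hsub : ∀ i j, HasSubgaussianMGF (fun ω => X i ω j) σ μ)

omit [IsProbabilityMeasure μ] in
include hX hε in
theorem measurable_data : Measurable fun ω => ((fun i => ε i ω, fun i => X i ω) :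
    (Fin n → ℝ) × (Fin n → EuclideanSpace ℝ (Fin (q + 1)))) :=
  (measurable_pi_iff.2 hε).prodMk (measurable_pi_iff.2 hX.measurable)

include hρ hτ hX hε hXε hσ hsub

theorem expSqBound_predictionFactor (i : Fin n) :
    ExpSqBound μ (fun ω => predictionFactor ρ τ (fun i => ε i ω) (fun i => X i ω) i)
      (1 / (4 * σ)) 3 := by
  have hm := hX.measurable
  have hf : Measurable fun v : EuclideanSpace ℝ (Fin (q + 1)) =>
      (WithLp.toLp 2 fun j => v (Fin.castSucc j) : EuclideanSpace ℝ (Fin q)) := by fun_prop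
  have hV : ∀ i, Measurable fun ω => firstEntries (fun i => X i ω) i := fun i => hf.comp (hm i)
  have hVind : iIndepFun (fun i ω => firstEntries (fun i => X i ω) i) μ :=
    hX.indep.comp (fun _ => fun v : EuclideanSpace ℝ (Fin (q + 1)) =>
      (WithLp.toLp 2 fun j => v (Fin.castSucc j) : EuclideanSpace ℝ (Fin q))) fun _ => hf
  have hVε : IndepFun (fun ω i => firstEntries (fun i => X i ω) i) (fun ω i => ε i ω) μ :=
    hXε.comp (φ := fun x => firstEntries x) continuous_firstEntries.measurable measurable_id
  have h1 := (indepFun_update_zero hV (measurable_pi_iff.2 hε) hVind hVε i).symm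
  have hW : Measurable fun ω => (Function.update (fun j => firstEntries (fun i => X i ω) j) i 0,
      fun i => ε i ω) := by
    refine Measurable.prodMk (measurable_pi_iff.2 fun j => ?_) (measurable_pi_iff.2 hε)
    by_cases hj : j = i
    · subst hj; simp
    · simpa [hj] using hV j
  refine expSqBound_normalizedForm_of_indepFun (ι := Fin q) hW
    (Y := fun ω j => firstEntries (fun i => X i ω) i j)
    (a := fun w j => estimator ρ τ w.2 w.1 j) (by have := hV i; fun_prop)
    (h1.comp measurable_id (ψ := fun v : EuclideanSpace ℝ (Fin q) => fun j => v j) (by fun_prop))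
    ?_ hσ (fun j => hsub i j.castSucc) ?_
  · exact (hX.indep_entries i).precomp (Fin.castSucc_injective q)
  · have h2 := (continuous_estimator (n := n) (d := q) hρ hτ).comp continuous_swap
    exact (continuous_pi fun j => (EuclideanSpace.proj (𝕜 := ℝ) j).continuous.comp h2).measurable

omit hρ hτ in
theorem expSqBound_normalizedForm_lastEntry
    {a : (Fin n → EuclideanSpace ℝ (Fin q)) × (Fin n → ℝ) → Fin n → ℝ} (ha : Measurable a) :
    ExpSqBound μ (fun ω => normalizedForm (a (firstEntries fun i => X i ω, fun i => ε i ω))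
      (lastEntry fun i => X i ω)) (1 / (4 * σ)) 3 := by
  have hm := measurable_pi_iff.2 hX.measurable
  refine expSqBound_normalizedForm_of_indepFun
    (W := fun ω => (firstEntries (fun i => X i ω), fun i => ε i ω))
    (Y := fun ω => lastEntry fun i => X i ω)
    ((continuous_firstEntries.measurable.comp hm).prodMk (measurable_pi_iff.2 hε))
    (measurable_pi_iff.2 fun i => hX.measurable_entry i (Fin.last q))
    (hX.indepFun_lastEntry (measurable_pi_iff.2 hε) hXε).symm ?_ hσ
    (fun i => hsub i (Fin.last q)) ha
  exact hX.iIndepFun_entries.precomp (g := fun i : Fin n => (i, Fin.last q))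
    fun i j h => (Prod.mk.inj h).1

theorem expSqBound_slopeFactor :
    ExpSqBound μ (fun ω => slopeFactor ρ τ (fun i => ε i ω) (fun i => X i ω)) (1 / (4 * σ)) 3 := by
  refine expSqBound_normalizedForm_lastEntry hX hε hXε hσ hsub
    (a := fun w i => deriv ρ (residual ρ τ w.2 w.1 i)) ?_
  have h1 := (continuous_residual (n := n) (d := q) hρ hτ).comp continuous_swap
  have h2 := hρ.continuous_deriv
  exact (continuous_pi fun i => h2.comp ((continuous_apply i).comp h1)).measurable

theorem expSqBound_loadingFactor (i : Fin n) :
    ExpSqBound μ (fun ω => loadingFactor ρ τ (fun i => ε i ω) (fun i => X i ω) i)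
      (1 / (4 * σ)) 3 := by
  refine expSqBound_normalizedForm_lastEntry hX hε hXε hσ hsub
    (a := fun w => loadings τ (fun i => deriv (deriv ρ) (residual ρ τ w.2 w.1 i))
      (fun i j => w.1 i j) i) ?_
  exact ((continuous_apply i).comp
    ((continuous_loadings (n := n) (d := q) hρ hτ).comp continuous_swap)).measurable

omit [IsProbabilityMeasure μ] hXε hσ hsub

theorem measurable_predictionFactor (i : Fin n) : Measurable fun ω =>
    predictionFactor ρ τ (fun i => ε i ω) (fun i => X i ω) i := by
  have hd := measurable_data hX hε
  have h1 : Continuous fun z : (Fin n → ℝ) × (Fin n → EuclideanSpace ℝ (Fin (q + 1))) =>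
      estimator ρ τ z.1 (Function.update (firstEntries z.2) i 0) :=
    (continuous_estimator hρ hτ).comp (continuous_fst.prodMk
      ((continuous_firstEntries.comp continuous_snd).update i continuous_const))
  have h2 := continuous_firstEntries (n := n) (q := q)
  have h3 : Continuous fun z : (Fin n → ℝ) × (Fin n → EuclideanSpace ℝ (Fin (q + 1))) =>
      ((fun j => estimator ρ τ z.1 (Function.update (firstEntries z.2) i 0) j,
        fun j => firstEntries z.2 i j) : (Fin q → ℝ) × (Fin q → ℝ)) := by fun_prop
  exact measurable_normalizedForm.comp (h3.measurable.comp hd)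

theorem measurable_slopeFactor : Measurable fun ω =>
    slopeFactor ρ τ (fun i => ε i ω) (fun i => X i ω) := by
  have hd := measurable_data hX hε
  have h1 := continuous_looResidual (n := n) (q := q) hρ hτ
  have h2 := hρ.continuous_deriv
  have h3 : Continuous fun z : (Fin n → ℝ) × (Fin n → EuclideanSpace ℝ (Fin (q + 1))) =>
      ((fun i => deriv ρ (looResidual ρ τ z.1 z.2 i), lastEntry z.2) :
        (Fin n → ℝ) × (Fin n → ℝ)) := by
    unfold lastEntry
    fun_prop
  exact measurable_normalizedForm.comp (h3.measurable.comp hd)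

theorem measurable_loadingFactor (i : Fin n) : Measurable fun ω =>
    loadingFactor ρ τ (fun i => ε i ω) (fun i => X i ω) i := by
  have hd := measurable_data hX hε
  have h1 : Continuous fun z : (Fin n → ℝ) × (Fin n → EuclideanSpace ℝ (Fin (q + 1))) =>
      loadings τ (weights ρ τ z.1 z.2) (fun i j => firstEntries z.2 i j) i :=
    (continuous_apply i).comp ((continuous_loadings (n := n) (d := q) hρ hτ).comp
      (continuous_fst.prodMk (continuous_firstEntries.comp continuous_snd)))
  have h3 : Continuous fun z : (Fin n → ℝ) × (Fin n → EuclideanSpace ℝ (Fin (q + 1))) =>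
      ((loadings τ (weights ρ τ z.1 z.2) (fun i j => firstEntries z.2 i j) i, lastEntry z.2) :
        (Fin n → ℝ) × (Fin n → ℝ)) := by
    unfold lastEntry
    fun_prop
  exact measurable_normalizedForm.comp (h3.measurable.comp hd)

theorem measurable_estimator : Measurable fun ω =>
    estimator ρ τ (fun i => ε i ω) fun i => X i ω := by
  have h := (continuous_estimator (n := n) (d := q + 1) hρ hτ).measurable
  have h2 := h.comp (measurable_data hX hε)
  exact h2

theorem measurable_bTilde : Measurable fun ω => bTilde ρ τ (fun i => ε i ω) fun i => X i ω := by
  have h := (continuous_bTilde (n := n) (q := q) hρ hτ).measurable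
  have h2 := h.comp (measurable_data hX hε)
  exact h2

theorem measurable_gothicB : Measurable fun ω => gothicB ρ τ (fun i => ε i ω) fun i => X i ω :=
  (continuous_gothicB hρ hτ).measurable.comp (measurable_data hX hε)

theorem measurable_residual (i : Fin n) : Measurable fun ω =>
    residual ρ τ (fun i => ε i ω) (fun i => X i ω) i :=
  ((continuous_apply i).comp (continuous_residual hρ hτ)).measurable.comp (measurable_data hX hε)

theorem measurable_looResidual (i : Fin n) : Measurable fun ω =>
    looResidual ρ τ (fun i => ε i ω) (fun i => X i ω) i :=
  ((continuous_apply i).comp (continuous_looResidual hρ hτ)).measurable.comp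
    (measurable_data hX hε)

end RandomFactors

/-! ### Uniformity in the sample size -/

section Asymptotics

variable {Ω : ℕ → Type*} [∀ n, MeasurableSpace (Ω n)] {μ : ∀ n, Measure (Ω n)}
  [∀ n, IsProbabilityMeasure (μ n)]

theorem exists_subgaussian_scale {d : ℕ → ℕ}
    {X : ∀ n, Fin n → Ω n → EuclideanSpace ℝ (Fin (d n + 1))} {C c : ℕ → ℝ} (hc : ∀ n, 0 < c n)
    (hcn : ∃ α : ℝ, (fun n => 1 / c n) =O[atTop] fun n : ℕ => Real.log n ^ α)
    (hCn : ∃ a : ℝ, C =O[atTop] fun n : ℕ => (n : ℝ) ^ a)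
    (hX : ∀ n, DesignAssumptions (μ n) (X n) (C n) (c n)) :
    ∃ (σ : ℕ → NNReal) (a : ℕ) (A : ℝ), ∀ᶠ n : ℕ in atTop, 0 < σ n ∧
      (σ n : ℝ) ≤ A * Real.log n ^ a ∧
      ∀ i j, HasSubgaussianMGF (fun ω => X n i ω j) (σ n) (μ n) := by
  obtain ⟨α, hα⟩ := hcn
  obtain ⟨b, hb⟩ := hCn
  obtain ⟨K, hK0, hK⟩ := hα.exists_pos
  obtain ⟨L, hL0, hL⟩ := hb.exists_pos
  set N := ⌈b⌉₊
  refine ⟨fun n => Real.toNNReal (2 * (1 + Real.log ((1 + C n) ^ 2)) / (c n / 4)), ⌈α⌉₊ + 1,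
    8 * (1 + 2 * (Real.log (1 + L) + N)) * K, ?_⟩
  filter_upwards [hK.bound, hL.bound, eventually_one_le_log, eventually_ge_atTop 1]
    with n h1 h2 hl hn
  have hn1 : (1 : ℝ) ≤ n := by exact_mod_cast hn
  have hC : 0 ≤ C n := ((hX n).hasSubgaussianMGF (hc n) ⟨0, hn⟩ 0).1
  have hc0 := hc n
  have hlog : 0 ≤ Real.log (1 + C n) := Real.log_nonneg (by linarith)
  have hlL : 0 ≤ Real.log (1 + L) := Real.log_nonneg (by linarith)
  have hsq : Real.log ((1 + C n) ^ 2) = 2 * Real.log (1 + C n) := by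
    rw [Real.log_pow]; norm_num
  have hpos : 0 < 2 * (1 + Real.log ((1 + C n) ^ 2)) / (c n / 4) := by
    rw [hsq]; positivity
  refine ⟨Real.toNNReal_pos.2 hpos, ?_, fun i j => ((hX n).hasSubgaussianMGF (hc n) i j).2⟩
  rw [Real.coe_toNNReal _ hpos.le, hsq]
  have h3 : 1 / c n ≤ K * Real.log n ^ ⌈α⌉₊ := by
    rw [Real.norm_of_nonneg (by positivity), Real.norm_of_nonneg (Real.rpow_nonneg (by linarith) _)]
      at h1
    exact h1.trans (by gcongr; exact rpow_le_pow_natCeil hl α)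
  have h4 : Real.log (1 + C n) ≤ (Real.log (1 + L) + N) * Real.log n := by
    have h5 : C n ≤ L * (n : ℝ) ^ N := by
      rw [Real.norm_of_nonneg hC, Real.norm_of_nonneg (by positivity)] at h2
      exact h2.trans (by gcongr; exact rpow_le_pow_natCeil hn1 b)
    have h6 : (1 : ℝ) ≤ (n : ℝ) ^ N := one_le_pow₀ hn1
    calc Real.log (1 + C n) ≤ Real.log ((1 + L) * (n : ℝ) ^ N) :=
          Real.log_le_log (by linarith) (by linarith)
      _ = Real.log (1 + L) + N * Real.log n := by
          rw [Real.log_mul (by positivity) (by positivity), Real.log_pow]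
      _ ≤ _ := by nlinarith
  calc 2 * (1 + 2 * Real.log (1 + C n)) / (c n / 4) =
        8 * (1 + 2 * Real.log (1 + C n)) * (1 / c n) := by field_simp; ring
    _ ≤ 8 * ((1 + 2 * (Real.log (1 + L) + N)) * Real.log n) * (K * Real.log n ^ ⌈α⌉₊) := by
        gcongr
        nlinarith
    _ = _ := by ring

theorem polyLog_of_expSqBound_scale {σ : ℕ → NNReal} {a : ℕ} {A : ℝ}
    (hσ : ∀ᶠ n : ℕ in atTop, 0 < σ n ∧ (σ n : ℝ) ≤ A * Real.log n ^ a) {Z : ∀ n, Ω n → ℝ}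
    (hZ : ∀ n, Measurable (Z n)) {M : ℕ → ℝ} {B : ℝ}
    (hM : ∀ᶠ n : ℕ in atTop, 1 ≤ M n ∧ Real.log (M n) ≤ B * Real.log n)
    (h : ∀ᶠ n : ℕ in atTop, ExpSqBound (μ n) (Z n) (1 / (4 * σ n)) (M n)) : PolyLog μ Z := by
  refine polyLog_of_expSq (fun n => (hZ n).aestronglyMeasurable) a (4 * |A| + |B|) ?_
  filter_upwards [hσ, hM, h, eventually_one_le_log] with n ⟨h1, h2⟩ ⟨h3, h4⟩ h5 hl
  have h1' : (0 : ℝ) < σ n := h1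
  refine ⟨_, _, by positivity, h3, h5, ?_, h4.trans ?_⟩
  · rw [one_div_one_div]
    have : (1 : ℝ) ≤ Real.log n ^ a := one_le_pow₀ hl
    nlinarith [le_abs_self A, abs_nonneg B]
  · have := le_abs_self B
    have := abs_nonneg A
    gcongr
    linarith

theorem polyLog_iSup_abs {σ : ℕ → NNReal} {a : ℕ} {A : ℝ}
    (hσ : ∀ᶠ n : ℕ in atTop, 0 < σ n ∧ (σ n : ℝ) ≤ A * Real.log n ^ a)
    {Z : ∀ n, Fin n → Ω n → ℝ} (hZ : ∀ n i, Measurable (Z n i))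
    (h : ∀ᶠ n : ℕ in atTop, ∀ i, ExpSqBound (μ n) (Z n i) (1 / (4 * σ n)) 3) :
    PolyLog μ fun n ω => ⨆ i, |Z n i ω| := by
  refine polyLog_of_expSqBound_scale hσ (fun n => Measurable.iSup fun i => (hZ n i).abs)
    (M := fun n => 1 + Fintype.card (Fin n) * 3) (B := Real.log 4 + 1) ?_
    (h.mono fun n hn => expSqBound_iSup_abs (hZ n) (by norm_num) hn)
  filter_upwards [eventually_one_le_log, eventually_ge_atTop 1] with n hl hn
  have hn1 : (1 : ℝ) ≤ n := by exact_mod_cast hn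
  rw [Fintype.card_fin]
  refine ⟨by linarith, ?_⟩
  have h4 : 0 ≤ Real.log 4 := Real.log_nonneg (by norm_num)
  calc Real.log (1 + n * 3) ≤ Real.log (4 * n) := Real.log_le_log (by positivity) (by linarith)
    _ = Real.log 4 + Real.log n := Real.log_mul (by norm_num) (by positivity)
    _ ≤ _ := by nlinarith

end Asymptotics

end RidgeM

end

open RidgeM MeasureTheory ProbabilityTheory Filter in
theorem mainTheorem4
    -- the loss and the regularization parameter
    (ρ : ℝ → ℝ) (hρ : RidgeM.LossAssumptions ρ) (τ : ℝ) (hτ : 0 < τ)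
    -- `p = q n + 1` predictors, with `p / n` tending to a finite non-zero limit
    (q : ℕ → ℕ) (κ : ℝ) (hκ : 0 < κ)
    (hqκ : Filter.Tendsto (fun n : ℕ => ((q n + 1 : ℕ) : ℝ) / (n : ℝ)) Filter.atTop (nhds κ))
    -- for each sample size `n`, a probability space, the design and the errors
    {Ω : ℕ → Type*} [∀ n, MeasurableSpace (Ω n)]
    (μ : ∀ n, MeasureTheory.Measure (Ω n)) [∀ n, MeasureTheory.IsProbabilityMeasure (μ n)]
    (X : ∀ n, Fin n → Ω n → EuclideanSpace ℝ (Fin (q n + 1)))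
    (ε : ∀ n, Fin n → Ω n → ℝ)
    -- the design, with `1 / c_n = O(polyLog(n))` and `C_n` at most polynomial in `n`
    (C c : ℕ → ℝ) (hc : ∀ n, 0 < c n)
    (hcn : ∃ α : ℝ, (fun n => 1 / c n) =O[Filter.atTop] fun n : ℕ => Real.log n ^ α)
    (hCn : ∃ a : ℝ, C =O[Filter.atTop] fun n : ℕ => (n : ℝ) ^ a)
    (hX : ∀ n, RidgeM.DesignAssumptions (μ n) (X n) (C n) (c n))
    -- the errors are independent, and independent of the design
    (hε : ∀ n i, Measurable (ε n i))
    (hεindep : ∀ n, ProbabilityTheory.iIndepFun (ε n) (μ n))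
    (hXε : ∀ n, ProbabilityTheory.IndepFun (fun ω i => X n i ω) (fun ω i => ε n i ω) (μ n))
    -- moments of `ψ(ε_i)` are bounded on average
    (hψ : ∀ k : ℕ, ∃ B : ℝ, ∀ᶠ n : ℕ in Filter.atTop,
      (∀ i, MeasureTheory.Integrable (fun ω => deriv ρ (ε n i ω) ^ (2 * k)) (μ n)) ∧
      (1 / (n : ℝ)) * ∑ i, ∫ ω, deriv ρ (ε n i ω) ^ (2 * k) ∂(μ n) ≤ B)
    -- `sup_i |ε_i|` is at most of the order of a power of `log n`
    (hεsup : RidgeM.BigOLk μ (fun n ω => ⨆ i, |ε n i ω|) (fun _ => 1)) :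
    -- the Euclidean error of the approximation
    RidgeM.BigOLk μ
      (fun n ω => ‖RidgeM.estimator ρ τ (fun i => ε n i ω) (fun i => X n i ω) -
        RidgeM.bTilde ρ τ (fun i => ε n i ω) (fun i => X n i ω)‖)
      (fun n => 1 / τ * (1 / (n : ℝ))) ∧
    -- the last coordinate
    RidgeM.BigOLk μ
      (fun n ω => Real.sqrt n *
        (RidgeM.estimator ρ τ (fun i => ε n i ω) (fun i => X n i ω) (Fin.last (q n)) -
          RidgeM.gothicB ρ τ (fun i => ε n i ω) (fun i => X n i ω)))
      (fun n => 1 / Real.sqrt n) ∧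
    -- the fitted values
    RidgeM.BigOLk μ
      (fun n ω => ⨆ i, |inner ℝ (X n i ω)
        (RidgeM.estimator ρ τ (fun i => ε n i ω) (fun i => X n i ω) -
          RidgeM.bTilde ρ τ (fun i => ε n i ω) (fun i => X n i ω))|)
      (fun n => 1 / Real.sqrt n) ∧
    -- the residuals
    RidgeM.BigOLk μ
      (fun n ω => ⨆ i, |RidgeM.residual ρ τ (fun i => ε n i ω) (fun i => X n i ω) i -
        RidgeM.looResidual ρ τ (fun i => ε n i ω) (fun i => X n i ω) i|)
      (fun n => 1 / Real.sqrt n) := by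
  obtain ⟨K, m, hb⟩ := hρ.exists_lossBounds
  have hK := hb.nonneg
  obtain ⟨σ, a, A, hσ⟩ := exists_subgaussian_scale hc hcn hCn hX
  have hσ' : ∀ᶠ n : ℕ in atTop, 0 < σ n ∧ (σ n : ℝ) ≤ A * Real.log n ^ a :=
    hσ.mono fun n hn => ⟨hn.1, hn.2.1⟩
  set e : ∀ n, Ω n → Fin n → ℝ := fun n ω i => ε n i ω with he
  set D : ∀ n, Ω n → Fin n → EuclideanSpace ℝ (Fin (q n + 1)) := fun n ω i => X n i ω with hD
  -- the random factors
  set E : ∀ n, Ω n → ℝ := fun n ω => ⨆ i, |ε n i ω|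
  set Q : ∀ n, Ω n → ℝ := fun n ω => 2 * netNorm (D n ω)
  set G₁ : ∀ n, Ω n → ℝ := fun n ω => ⨆ i, |predictionFactor ρ τ (e n ω) (D n ω) i|
  set G₂ : ∀ n, Ω n → ℝ := fun n ω => |slopeFactor ρ τ (e n ω) (D n ω)|
  set G₃ : ∀ n, Ω n → ℝ := fun n ω => ⨆ i, |loadingFactor ρ τ (e n ω) (D n ω) i|
  set G₄ : ∀ n, Ω n → ℝ := fun n ω => ⨆ i, |X n i ω (Fin.last (q n))|
  have hE : PolyLog μ E := hεsup
  have hG₁ : PolyLog μ G₁ :=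
    polyLog_iSup_abs hσ' (fun n i => measurable_predictionFactor hρ hτ (hX n) (hε n) i)
      (hσ.mono fun n hn i =>
        expSqBound_predictionFactor hρ hτ (hX n) (hε n) (hXε n) hn.1 hn.2.2 i)
  have hG₃ : PolyLog μ G₃ :=
    polyLog_iSup_abs hσ' (fun n i => measurable_loadingFactor hρ hτ (hX n) (hε n) i)
      (hσ.mono fun n hn i => expSqBound_loadingFactor hρ hτ (hX n) (hε n) (hXε n) hn.1 hn.2.2 i)
  have hG₄ : PolyLog μ G₄ :=
    polyLog_iSup_abs hσ' (fun n i => (hX n).measurable_entry i _)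
      (hσ.mono fun n hn i => (hn.2.2 i _).expSqBound ((hX n).measurable_entry i _) hn.1)
  have hG₂ : PolyLog μ G₂ := by
    refine polyLog_of_expSqBound_scale hσ'
      (fun n => (measurable_slopeFactor hρ hτ (hX n) (hε n)).abs) (M := fun _ => 3)
      (B := Real.log 3) ?_ (hσ.mono fun n hn =>
        (expSqBound_slopeFactor hρ hτ (hX n) (hε n) (hXε n) hn.1 hn.2.2).mono
          (fun ω => by rw [sq_abs]) le_rfl)
    filter_upwards [eventually_one_le_log] with n hn
    exact ⟨by norm_num, le_mul_of_one_le_right (Real.log_nonneg (by norm_num)) hn⟩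
  have hQ : PolyLog μ Q := by
    have hmn : ∀ n, Measurable fun ω => netNorm (D n ω) := fun n =>
      Measurable.iSup fun v => Measurable.abs (by
        have := (hX n).measurable
        unfold empiricalNorm
        fun_prop)
    have h1 : PolyLog μ fun n ω => netNorm (D n ω) := by
      refine polyLog_of_expSqBound_scale hσ' hmn
        (M := fun n => (5 ^ (q n + 1 + n + 1)) ^ (1 / (n : ℝ))) (B := (κ + 3) * Real.log 5) ?_ ?_
      · filter_upwards [eventually_one_le_log, eventually_ge_atTop 1,
          hqκ.eventually_le_const (lt_add_one κ)] with n hl hn hκn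
        have hn' : (1 : ℝ) ≤ n := by exact_mod_cast hn
        have h5 : 0 < Real.log 5 := Real.log_pos (by norm_num)
        refine ⟨Real.one_le_rpow (one_le_pow₀ (by norm_num)) (by positivity), ?_⟩
        rw [Real.log_rpow (by positivity), Real.log_pow]
        have h6 : 1 / (n : ℝ) * ((q n + 1 + n + 1 : ℕ) : ℝ) ≤ κ + 3 := by
          rw [div_le_iff₀ (by linarith)] at hκn
          rw [one_div, ← div_eq_inv_mul, div_le_iff₀ (by linarith)]
          push_cast at hκn ⊢
          nlinarith
        calc _ = 1 / (n : ℝ) * ((q n + 1 + n + 1 : ℕ) : ℝ) * Real.log 5 := by ring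
          _ ≤ (κ + 3) * Real.log 5 := by gcongr
          _ ≤ _ := le_mul_of_one_le_right (by positivity) hl
      · filter_upwards [hσ, eventually_ge_atTop 1] with n hn hn1
        exact expSqBound_netNorm (hX n) hn1 hn.1 hn.2.2
    exact (PolyLog.const 2).mul h1
  -- the deterministic bounds are polynomials in the random factors
  set R : ∀ n, Ω n → ℝ := fun n ω => residualBound K m τ (E n ω) (G₁ n ω)
  set B : ∀ n, Ω n → ℝ := fun n ω => slopeBound K m τ (R n ω) (G₂ n ω)
  set P : ∀ n, Ω n → ℝ := fun n ω => projectedBound K m τ (R n ω) (Q n ω) (G₄ n ω) (G₃ n ω)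
  set T : ∀ n, Ω n → ℝ := fun n ω => errorBound K m (R n ω) (Q n ω) (B n ω) (P n ω)
  have hcst : ∀ x : ℝ, PolyLog μ fun _ _ => x := PolyLog.const
  have hR : PolyLog μ R := by
    have h1 := (hcst 1).add hE
    simp only [R, residualBound, div_eq_mul_inv]
    exact h1.add (hG₁.mul ((hcst 1).add (((hcst 2).mul ((hcst K).mul (h1.pow m))).mul
      (hcst τ⁻¹))))
  have hKR : PolyLog μ fun n ω => K * R n ω ^ m := (hcst K).mul (hR.pow m)
  have hB : PolyLog μ B := by
    simp only [B, slopeBound, div_eq_mul_inv]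
    exact (hG₂.mul hKR).mul (hcst τ⁻¹)
  have hP : PolyLog μ P := by
    simp only [P, projectedBound, div_eq_mul_inv]
    exact hG₄.add (hG₃.mul ((hcst 1).add ((hKR.mul (hQ.pow 2)).mul (hcst τ⁻¹))))
  have hBP : PolyLog μ fun n ω => B n ω * P n ω := hB.mul hP
  have hT : PolyLog μ T :=
    hQ.mul (((hcst K).mul ((hR.add hBP).pow m)).mul (hBP.pow 2))
  -- positivity
  have hE0 : ∀ n ω, 0 ≤ E n ω := fun n ω => Real.iSup_nonneg fun _ => abs_nonneg _
  have hG₁0 : ∀ n ω, 0 ≤ G₁ n ω := fun n ω => Real.iSup_nonneg fun _ => abs_nonneg _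
  have hG₂0 : ∀ n ω, 0 ≤ G₂ n ω := fun n ω => abs_nonneg _
  have hG₃0 : ∀ n ω, 0 ≤ G₃ n ω := fun n ω => Real.iSup_nonneg fun _ => abs_nonneg _
  have hG₄0 : ∀ n ω, 0 ≤ G₄ n ω := fun n ω => Real.iSup_nonneg fun _ => abs_nonneg _
  have hQ0 : ∀ n ω, 0 ≤ Q n ω := fun n ω =>
    mul_nonneg zero_le_two (Real.iSup_nonneg fun _ => abs_nonneg _)
  have hR1 : ∀ n ω, 1 ≤ R n ω := fun n ω => one_le_residualBound hτ hb (hE0 n ω) (hG₁0 n ω)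
  have hB0 : ∀ n ω, 0 ≤ B n ω := fun n ω => by
    have := hG₂0 n ω
    have := hR1 n ω
    simp only [B, slopeBound]
    positivity
  have hP0 : ∀ n ω, 0 ≤ P n ω := fun n ω => by
    have := hG₃0 n ω
    have := hG₄0 n ω
    have := hR1 n ω
    simp only [P, projectedBound]
    positivity
  -- pointwise bounds
  have hle : ∀ n (f : Fin n → ℝ) i, |f i| ≤ ⨆ i, |f i| := fun n f i =>
    le_ciSup (f := fun i => |f i|) (Set.finite_range _).bddAbove i
  have hop : ∀ n ω v, ∑ i, inner ℝ (D n ω i) v ^ 2 ≤ n * Q n ω ^ 2 * ‖v‖ ^ 2 :=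
    fun n ω v => sum_inner_sq_le (D n ω) v
  have hres : ∀ n ω i, |looResidual ρ τ (e n ω) (D n ω) i| ≤ R n ω := fun n ω =>
    abs_looResidual_le hρ hτ hb (hE0 n ω) (hG₁0 n ω) (hle n fun i => ε n i ω) fun i => by
      have h1 := abs_sum_mul_le_of_normalizedForm
        (hle n (fun i => predictionFactor ρ τ (e n ω) (D n ω) i) i)
      rw [real_inner_comm, inner_eq_sum, EuclideanSpace.norm_eq]
      simpa only [Real.norm_eq_abs, sq_abs] using h1
  have hslope : ∀ n, 0 < n → ∀ ω, |gothicB ρ τ (e n ω) (D n ω)| ≤ B n ω * (1 / Real.sqrt n) :=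
    fun n hn ω => abs_gothicB_le hρ hτ hb hn (hR1 n ω) (hG₂0 n ω) (hres n ω)
      (abs_sum_mul_le_of_normalizedForm le_rfl)
  have hproj : ∀ n, 0 < n → ∀ ω i, |projected ρ τ (e n ω) (D n ω) i| ≤ P n ω :=
    fun n hn ω => abs_projected_le hρ hτ hb hn (hR1 n ω) (hG₃0 n ω) (hres n ω) (hop n ω)
      (hle n fun i => X n i ω (Fin.last (q n))) fun i => abs_sum_mul_le_of_normalizedForm
        (hle n (fun i => loadingFactor ρ τ (e n ω) (D n ω) i) i)
  have hmain : ∀ n, 0 < n → ∀ ω, ‖estimator ρ τ (e n ω) (D n ω) - bTilde ρ τ (e n ω) (D n ω)‖ ≤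
      T n ω * (1 / τ * (1 / (n : ℝ))) := fun n hn ω =>
    norm_estimator_sub_bTilde_le hρ hτ hb hn (hR1 n ω) (hQ0 n ω) (hB0 n ω) (hP0 n ω) (hres n ω)
      (hop n ω) (hslope n hn ω) (hproj n hn ω)
  have hnn : ∀ n : ℕ, 0 < n → Real.sqrt n * (1 / (n : ℝ)) = 1 / Real.sqrt n := fun n hn => by
    have hn' : (0 : ℝ) < n := Nat.cast_pos.2 hn
    rw [mul_one_div, Real.sqrt_div_self']
  have hfit : ∀ n, 0 < n → ∀ ω i, |inner ℝ (X n i ω) (estimator ρ τ (e n ω) (D n ω) -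
      bTilde ρ τ (e n ω) (D n ω))| ≤ Q n ω * (T n ω * (1 / τ)) * (1 / Real.sqrt n) :=
    fun n hn ω i => by
      have h1 : ‖X n i ω‖ ≤ Real.sqrt n * Q n ω := by
        refine (sq_le_sq₀ (norm_nonneg _) (mul_nonneg (Real.sqrt_nonneg _) (hQ0 n ω))).1 ?_
        rw [mul_pow, Real.sq_sqrt (Nat.cast_nonneg n)]
        exact norm_sq_le_of_sum_inner_sq_le (hop n ω) i
      refine (abs_real_inner_le_norm _ _).trans ?_
      calc _ ≤ Real.sqrt n * Q n ω * (T n ω * (1 / τ * (1 / (n : ℝ)))) :=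
            mul_le_mul h1 (hmain n hn ω) (norm_nonneg _)
              (mul_nonneg (Real.sqrt_nonneg _) (hQ0 n ω))
        _ = Q n ω * (T n ω * (1 / τ)) * (Real.sqrt n * (1 / (n : ℝ))) := by ring
        _ = _ := by rw [hnn n hn]
  have hsup : ∀ n (f : Fin n → ℝ) (M : ℝ), 0 ≤ M → (∀ i, |f i| ≤ M) → |(⨆ i, |f i|)| ≤ M :=
    fun n f M hM hf => by
      rw [abs_of_nonneg (Real.iSup_nonneg fun _ => abs_nonneg _)]
      exact Real.iSup_le hf hM
  -- measurability
  have hest := fun n => measurable_estimator hρ hτ (hX n) (hε n)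
  have hbt := fun n => measurable_bTilde hρ hτ (hX n) (hε n)
  have hgb := fun n => measurable_gothicB hρ hτ (hX n) (hε n)
  have hmX : ∀ n i, Measurable (X n i) := fun n => (hX n).measurable
  have hrs := fun n => measurable_residual hρ hτ (hX n) (hε n)
  have hlr := fun n => measurable_looResidual hρ hτ (hX n) (hε n)
  have hsq0 : ∀ n : ℕ, 0 ≤ 1 / Real.sqrt n := fun n => by positivity
  have hT' : PolyLog μ fun n ω => T n ω * (1 / τ) := hT.mul (hcst _)
  refine ⟨BigOLk.of_le (fun n => ((hest n).sub (hbt n)).norm.aestronglyMeasurable) hT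
      (fun n => by positivity) ?_,
    BigOLk.of_le (fun n => Measurable.aestronglyMeasurable ?_) hT' hsq0 ?_,
    BigOLk.of_le (fun n => (Measurable.iSup fun i => Measurable.abs ?_).aestronglyMeasurable)
      (hQ.mul hT') hsq0 ?_,
    BigOLk.of_le (fun n => (Measurable.iSup fun i =>
      ((hrs n i).sub (hlr n i)).abs).aestronglyMeasurable) (hBP.add (hQ.mul hT')) hsq0 ?_⟩
  · filter_upwards [eventually_gt_atTop 0] with n hn ω
    rw [abs_norm]
    exact hmain n hn ω
  · have h1 := hest n
    have h2 := hgb n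
    fun_prop
  · filter_upwards [eventually_gt_atTop 0] with n hn ω
    have h1 : |estimator ρ τ (e n ω) (D n ω) (Fin.last (q n)) - gothicB ρ τ (e n ω) (D n ω)| ≤
        T n ω * (1 / τ * (1 / (n : ℝ))) := by
      rw [← bTilde_last]
      exact (PiLp.norm_apply_le (estimator ρ τ (e n ω) (D n ω) - bTilde ρ τ (e n ω) (D n ω))
        (Fin.last (q n))).trans (hmain n hn ω)
    rw [abs_mul, abs_of_nonneg (Real.sqrt_nonneg _), ← hnn n hn]
    calc _ ≤ Real.sqrt n * (T n ω * (1 / τ * (1 / (n : ℝ)))) := by gcongr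
      _ = _ := by ring
  · exact (hmX n i).inner ((hest n).sub (hbt n))
  · filter_upwards [eventually_gt_atTop 0] with n hn ω
    exact hsup n _ _ ((abs_nonneg _).trans (hfit n hn ω ⟨0, hn⟩)) (hfit n hn ω)
  · filter_upwards [eventually_gt_atTop 0] with n hn ω
    have h1 : ∀ i, |residual ρ τ (e n ω) (D n ω) i - looResidual ρ τ (e n ω) (D n ω) i| ≤
        (B n ω * P n ω + Q n ω * (T n ω * (1 / τ))) * (1 / Real.sqrt n) := fun i => by
      have h2 : residual ρ τ (e n ω) (D n ω) i - looResidual ρ τ (e n ω) (D n ω) i =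
          -(gothicB ρ τ (e n ω) (D n ω) * projected ρ τ (e n ω) (D n ω) i) -
            inner ℝ (X n i ω) (estimator ρ τ (e n ω) (D n ω) - bTilde ρ τ (e n ω) (D n ω)) := by
        have h3 := sub_inner_bTilde ρ τ (e n ω) (D n ω) i
        have h4 : D n ω i = X n i ω := rfl
        rw [h4] at h3
        rw [RidgeM.residual, inner_sub_right, h4]
        linarith
      rw [h2]
      refine (abs_sub _ _).trans ?_
      rw [abs_neg, abs_mul, add_mul]
      refine add_le_add ?_ (hfit n hn ω i)
      calc _ ≤ B n ω * (1 / Real.sqrt n) * P n ω :=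
            mul_le_mul (hslope n hn ω) (hproj n hn ω i) (abs_nonneg _)
              (mul_nonneg (hB0 n ω) (hsq0 n))
        _ = _ := by ring
    exact hsup n _ _ ((abs_nonneg _).trans (h1 ⟨0, hn⟩)) h1
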